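/- Let $m>0$ and $\ell>0$. For $s\in\mathbb R$ and $x\in(-\ell,\ell)$ let $$\Psi(s,x)=\sqrt{\tfrac{\ell}{\pi}}\,(\ell+x)^{-\frac12-\mathrm i s}(\ell-x)^{-\frac12+\mathrm i s},\qquad \Psi^{(k)}_a(s,x)=\delta^k_a\,\Psi(s,x)\quad(k,a\in\{1,2\})$$ be the generalised eigenfunctions of the massless fermionic two-point function on $[-\ell,\ell]$, and let $\mathcal K$ be the first-order (order $m\ln m$) perturbation kernel $$\mathcal K_{11}=\mathcal K_{22}=0,\qquad \mathcal K_{12}(x,y)=-\mathcal K_{21}(x,y)=-\frac{m}{2\pi\mathrm i}\ln\Bigl(\frac{m|x-y|}{2}\mathrm e^{\gamma_E}\Bigr),$$ where $\gamma_E$ is the Euler–Mascheroni constant. Put $$K(s,t)=\frac{\mathrm i}{2\pi\ell}\int_{-\ell}^{\ell}\!\int_{-\ell}^{\ell}\Psi^*(s,x)\,\ln\Bigl(\frac{m|x-y|}{2}\mathrm e^{\gamma_E}\Bigr)\Psi(t,y)\,\mathrm dx\,\mathrm dy .$$ Then all the double integrals here and below converge absolutely, and for all $s,t\in\mathbb R$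 and $k,l\in\{1,2\}$ the matrix elements of $\mathcal K$ are $$\sum_{a,b}\int_{-\ell}^{\ell}\!\int_{-\ell}^{\ell}\Psi^{(k)*}_a(s,x)\,\mathcal K_{ab}(x,y)\,\Psi^{(l)}_b(t,y)\,\mathrm dx\,\mathrm dy = m\ell\,\epsilon_{kl}\,K(s,t),$$ with $\epsilon_{12}=1$, $\epsilon_{21}=-1$, $\epsilon_{11}=\epsilon_{22}=0$. With the digamma function $\psi=\Gamma'/\Gamma$ one has, for $s\neq t$, $$K(s,t)=\frac{\mathrm i\ln(m\ell\mathrm e^{2\gamma_E})}{2\cosh(\pi s)\cosh(\pi t)}-\frac{\mathrm i\tanh(\pi t)}{4\sinh[\pi(s-t)]}\bigl[\psi(\tfrac12+\mathrm is)+\psi(\tfrac12-\mathrm is)\bigr]+\frac{\mathrm i\tanh(\pi s)}{4\sinh[\pi(s-t)]}\bigl[\psi(\tfrac12+\mathrm it)+\psi(\tfrac12-\mathrm it)\bigr],$$ and on the diagonal $$K(s,s)=\frac{\mathrm i}{4\cosh^2(\pi s)}\bigl[\psi(\tfrac12+\mathrm is)+\psi(\tfrac12-\mathrm is)+2\ln(m\ell\mathrm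 e^{2\gamma_E})\bigr]-\frac{\tanh(\pi s)}{4\pi}\bigl[\psi'(\tfrac12-\mathrm is)-\psi'(\tfrac12+\mathrm is)\bigr].$$ The function $K$ is $C^\infty$ on $\mathbb R^2$, and $K(s,t)=K(t,s)=K(-s,-t)$. It decays rapidly in each variable: for each fixed $t$ the function $s\mapsto K(s,t)$ is a Schwartz function, and for each fixed $s$ so is $t\mapsto K(s,t)$. Moreover, for every $c<\pi$ there is a constant $C$ (depending on $c$, $m$ and $\ell$) with $$|K(s,t)|\le \frac{C\,\mathrm e^{-c|s-t|}}{1+|s|+|t|}\qquad\text{for all } s,t\in\mathbb R;$$ in particular $K$ is bounded and tends to $0$ at infinity. -/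

import Mathlib

/-!  Matrix elements of the first-order mass perturbation of the fermionic two-point function on the
interval `[-ℓ, ℓ]` in the generalised eigenbasis of the massless two-point function. -/

noncomputable section

namespace MassPerturbation

/-- The function `Ψ(s, x) = √(ℓ/π) (ℓ + x)^(-1/2 - i s) (ℓ - x)^(-1/2 + i s)` for `x ∈ (-ℓ, ℓ)`. -/
def Psi (ℓ s x : ℝ) : ℂ :=
  (Real.sqrt (ℓ / Real.pi) : ℂ)
    * ((ℓ + x : ℝ) : ℂ) ^ (-(1 / 2 : ℂ) - Complex.I * (s : ℂ))
    * ((ℓ - x : ℝ) : ℂ) ^ (-(1 / 2 : ℂ) + Complex.I * (s : ℂ))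

/-- The component `a` of the massless generalised eigenvector number `k`:
`Ψ^(k)_a(s, x) = δ^k_a Ψ(s, x)`. -/
def eigenvector (ℓ : ℝ) (k a : Fin 2) (s x : ℝ) : ℂ :=
  if a = k then Psi ℓ s x else 0

/-- The logarithm `ln((m |x - y| / 2) e^γ)`, with the Euler–Mascheroni constant `γ`. -/
def logTerm (m x y : ℝ) : ℝ :=
  Real.log (m * |x - y| / 2 * Real.exp Real.eulerMascheroniConstant)

/-- The first-order (that is, order `m ln m`) perturbation kernel: the `2 × 2` matrix kernel with
vanishing diagonal and off-diagonal components `∓ (m / (2 π i)) ln((m |x - y| / 2) e^γ)`. -/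
def perturbationKernel (m x y : ℝ) : Matrix (Fin 2) (Fin 2) ℂ :=
  !![0, -((m : ℂ) / (2 * (Real.pi : ℂ) * Complex.I)) * (logTerm m x y : ℂ);
    ((m : ℂ) / (2 * (Real.pi : ℂ) * Complex.I)) * (logTerm m x y : ℂ), 0]

/-- The square `[-ℓ, ℓ] × [-ℓ, ℓ]`. -/
def square (ℓ : ℝ) : Set (ℝ × ℝ) := Set.Icc (-ℓ) ℓ ×ˢ Set.Icc (-ℓ) ℓ

/-- The summand with spinor indices `a, b` in the integrand of the matrix element with
indices `k, l`, as a function of `p = (x, y)`. -/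
def matrixIntegrand (m ℓ : ℝ) (k l a b : Fin 2) (s t : ℝ) (p : ℝ × ℝ) : ℂ :=
  (starRingEnd ℂ) (eigenvector ℓ k a s p.1) * perturbationKernel m p.1 p.2 a b
    * eigenvector ℓ l b t p.2

/-- The matrix element `K^(kl)(s, t) = (Ψ^(k)(s), 𝒦 Ψ^(l)(t))`. -/
def matrixElement (m ℓ : ℝ) (k l : Fin 2) (s t : ℝ) : ℂ :=
  ∑ a, ∑ b, ∫ p in square ℓ, matrixIntegrand m ℓ k l a b s t p

/-- The antisymmetric symbol with `ε₁₂ = 1`. -/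
def epsilon : Matrix (Fin 2) (Fin 2) ℂ := !![0, 1; -1, 0]

/-- The integrand of the scalar kernel `K(s, t)`, as a function of `p = (x, y)`. -/
def scalarIntegrand (m ℓ s t : ℝ) (p : ℝ × ℝ) : ℂ :=
  (starRingEnd ℂ) (Psi ℓ s p.1) * (logTerm m p.1 p.2 : ℂ) * Psi ℓ t p.2

/-- The scalar kernel
`K(s, t) = (i / (2 π ℓ)) ∬ Ψ*(s, x) ln((m |x - y| / 2) e^γ) Ψ(t, y) dx dy`. -/
def scalarKernel (m ℓ s t : ℝ) : ℂ :=
  Complex.I / (2 * (Real.pi : ℂ) * (ℓ : ℂ)) * ∫ p in square ℓ, scalarIntegrand m ℓ s t p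

/-- The sum `ψ(1/2 + i s) + ψ(1/2 - i s)` of digamma functions. -/
def digammaSum (s : ℝ) : ℂ :=
  Complex.digamma (1 / 2 + Complex.I * (s : ℂ)) + Complex.digamma (1 / 2 - Complex.I * (s : ℂ))

/-- The constant `ln(m ℓ e^(2 γ))`. -/
def logConst (m ℓ : ℝ) : ℝ :=
  Real.log (m * ℓ * Real.exp (2 * Real.eulerMascheroniConstant))

end MassPerturbation

end

/-!
# Matrix elements of the first-order mass perturbation on an interval

In the rapidity coordinates `x = ℓ tanh u`, `y = ℓ tanh v` the generalised eigenfunctions become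
plane waves (`Psi_tanh`), and `K(s, t)` is, up to the factor `i / (2 π ^ 2)`, the double Fourier
integral of `(c + log |sinh (u - v)| - log cosh u - log cosh v) / (cosh u cosh v)` against
`exp (2 i s u - 2 i t v)` (`scalarKernel_eq_integral`). This function is integrable even with an
exponential weight (`integrable_exp_mul_rapidityKernel`), so that the double integrals converge
absolutely and `K` is smooth.

*Explicit form.* The Beta integral gives the Fourier transform of `cosh ^ (-a)` and, for `a < 1`,
the half-line sine and cosine transforms of `sinh ^ (-a)`, all in terms of the single quotient
`2 ^ (a - 1) Γ(a / 2 + i s) Γ(a / 2 - i s) / Γ(a)`. Derivatives in the exponent at `a = 1` produce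
the logarithms on one side and digamma functions on the other (`integral_log_cosh`,
`integral_log_sinh_mul_sin`). For the term `log |sinh (u - v)|`, after the shear `w = u - v` the
`v` integral of `1 / (cosh (w + v) cosh v)` is elementary, because this function equals
`(tanh (w + v) - tanh v) / sinh w`; the remaining `w` integral is the sine transform of
`log sinh / sinh`, once at `s` and once at `t` (`integral_log_sinh_kernel`). This proves
`scalarKernel_of_ne`. The diagonal values (`scalarKernel_self`) are limits of it, by continuity and
L'Hôpital's rule, and the symmetries are read off.

*Decay.* The explicit form splits into a term of size `1 / (cosh (π s) cosh (π t))`, up to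
polynomial factors, and a term `(S(s) - S(t)) / sinh (π (s - t))` with the digamma sum `S`. The
same differentiation at `a = 1` of the cosine transforms gives
`S(s) - S(t) = 4 ∫ sin ((s + t) w) sin ((s - t) w) / sinh w` over `w > 0` (`digammaSum_sub`). The
factor `sin ((s - t) w)` makes this vanish on the diagonal, and an integration by parts gains
`1 / (1 + |s + t|)` (`norm_digammaSum_sub_le`). Together this is `norm_scalarKernel_le`, with any
rate below `π`.

*Schwartz property.* All derivatives of `K` in one variable are bounded, since it is a Fourier
transform of a function with finite moments. With the exponential decay of `K` itself,
interpolation shows that all derivatives decay exponentially (`exists_schwartzMap`).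
-/

namespace MassPerturbation

open Complex Set MeasureTheory Filter Topology

/-! ### The Fourier transform of a power of `cosh` -/

/-- The substitution `y = e ^ u / (2 cosh u) = 1 / (1 + e ^ (-2 u))` maps the line onto `(0, 1)`;
it turns the Beta integral with parameters `a / 2 ± i s` into the Fourier transform of
`cosh ^ (-a)`. -/
theorem image_logistic_univ :
    (fun u : ℝ => Real.exp u / (2 * Real.cosh u)) '' univ = Ioo 0 1 := by
  ext y
  constructor
  · rintro ⟨u, -, rfl⟩
    have h1 := Real.exp_pos u
    have h2 := Real.exp_pos (-u)
    have h3 := Real.cosh_pos u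
    refine ⟨by positivity, ?_⟩
    rw [div_lt_one (by positivity), Real.cosh_eq]
    linarith
  · rintro ⟨h0, h1⟩
    have h2 : 0 < y / (1 - y) := div_pos h0 (by linarith)
    refine ⟨Real.log (y / (1 - y)) / 2, mem_univ _, ?_⟩
    set u := Real.log (y / (1 - y)) / 2 with hu
    have h3 : Real.exp u * Real.exp u = y / (1 - y) := by
      rw [← Real.exp_add, hu, add_halves, Real.exp_log h2]
    have h4 : Real.exp u * Real.exp (-u) = 1 := by rw [← Real.exp_add]; simp
    have h5 : (1 - y) * (Real.exp u * Real.exp u) = y := by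
      rw [h3]; field_simp [show 1 - y ≠ 0 by linarith]
    have h6 := Real.exp_pos u
    have h7 := Real.exp_pos (-u)
    simp only [Real.cosh_eq]
    rw [div_eq_iff (by positivity)]
    have : Real.exp u * ((1 - y) * Real.exp u - y * Real.exp (-u)) = 0 := by
      linear_combination h5 - y * h4
    have := (mul_eq_zero.1 this).resolve_left h6.ne'
    linarith

theorem hasDerivAt_logistic (u : ℝ) :
    HasDerivAt (fun u : ℝ => Real.exp u / (2 * Real.cosh u)) (1 / (2 * Real.cosh u ^ 2)) u := by
  have h := (Real.hasDerivAt_exp u).div ((Real.hasDerivAt_cosh u).const_mul 2)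
    (by have := Real.cosh_pos u; positivity)
  refine h.congr_deriv ?_
  have h1 := Real.cosh_pos u
  have h2 : Real.exp u * (Real.cosh u - Real.sinh u) = 1 := by
    rw [Real.cosh_sub_sinh, ← Real.exp_add]; simp
  rw [div_eq_div_iff (by positivity) (by positivity)]
  linear_combination (4 * Real.cosh u ^ 2) * h2

theorem logistic_integrand (a s u : ℝ) :
    (1 / (2 * Real.cosh u ^ 2) : ℝ) •
      (((Real.exp u / (2 * Real.cosh u) : ℝ) : ℂ) ^ ((a / 2 + I * s : ℂ) - 1)
        * (1 - ((Real.exp u / (2 * Real.cosh u) : ℝ) : ℂ)) ^ ((a / 2 - I * s : ℂ) - 1))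
    = ((2 ^ (1 - a) : ℝ) : ℂ) * (((Real.cosh u) ^ (-a) : ℝ) * cexp (2 * I * s * u)) := by
  have hc := Real.cosh_pos u
  have h1 : (1 - ((Real.exp u / (2 * Real.cosh u) : ℝ) : ℂ))
      = ((Real.exp (-u) / (2 * Real.cosh u) : ℝ) : ℂ) := by
    rw [← ofReal_one, ← ofReal_sub]
    congr 1
    rw [eq_div_iff (by positivity), sub_mul, div_mul_cancel₀ _ (by positivity), Real.cosh_eq]
    ring
  have h2 : ∀ x : ℝ, Real.log (Real.exp x / (2 * Real.cosh u))
      = x - Real.log 2 - Real.log (Real.cosh u) := by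
    intro x
    rw [Real.log_div (Real.exp_pos _).ne' (by positivity), Real.log_exp,
      Real.log_mul (by norm_num) hc.ne']
    ring
  have h3 : ∀ x : ℝ, 0 < Real.exp x / (2 * Real.cosh u) := fun x =>
    div_pos (Real.exp_pos _) (by positivity)
  have h4 : (1 / (2 * Real.cosh u ^ 2) : ℝ)
      = Real.exp (- Real.log 2 - 2 * Real.log (Real.cosh u)) := by
    rw [Real.exp_sub, Real.exp_neg, Real.exp_log two_pos, two_mul (Real.log (Real.cosh u)),
      Real.exp_add, Real.exp_log hc]
    field_simp
  rw [h1, cpow_def_of_ne_zero (ofReal_ne_zero.2 (h3 _).ne'),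
    cpow_def_of_ne_zero (ofReal_ne_zero.2 (h3 _).ne'), ← ofReal_log (h3 _).le,
    ← ofReal_log (h3 _).le, h2, h2, Real.rpow_def_of_pos hc, Real.rpow_def_of_pos two_pos, h4,
    real_smul]
  push_cast
  simp only [← Complex.exp_add]
  congr 1
  ring

theorem monotone_logistic : MonotoneOn (fun u : ℝ => Real.exp u / (2 * Real.cosh u)) univ := by
  refine monotoneOn_of_deriv_nonneg convex_univ (fun u _ =>
    (hasDerivAt_logistic u).continuousAt.continuousWithinAt) (fun u _ =>
    (hasDerivAt_logistic u).differentiableAt.differentiableWithinAt) fun u _ => ?_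
  rw [(hasDerivAt_logistic u).deriv]
  positivity

theorem integrable_cosh_rpow {a : ℝ} (ha : 0 < a) :
    Integrable fun u : ℝ => Real.cosh u ^ (-a) := by
  have h := betaIntegral_convergent (u := a / 2 + I * (0 : ℝ)) (v := a / 2 - I * (0 : ℝ))
    (by simp [ha]) (by simp [ha])
  rw [intervalIntegrable_iff_integrableOn_Ioo_of_le zero_le_one, ← image_logistic_univ,
    integrableOn_image_iff_integrableOn_deriv_smul_of_monotoneOn MeasurableSet.univ
      (fun u _ => (hasDerivAt_logistic u).hasDerivWithinAt) monotone_logistic] at h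
  simp only [logistic_integrand] at h
  rw [integrableOn_univ] at h
  have h2 := (h.const_mul ((2 ^ (1 - a) : ℝ) : ℂ)⁻¹).re
  refine h2.congr (ae_of_all _ fun u => ?_)
  have h0 : ((2 ^ (1 - a) : ℝ) : ℂ) ≠ 0 := ofReal_ne_zero.2 (by positivity)
  simp only [inv_mul_cancel_left₀ h0]
  simp

/-- The Beta integral `B(a / 2 + i s, a / 2 - i s)` after the logistic substitution. -/
theorem integral_cosh_rpow {a : ℝ} (ha : 0 < a) (s : ℝ) :
    ∫ u : ℝ, ((Real.cosh u ^ (-a) : ℝ) : ℂ) * cexp (2 * I * s * u)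
      = ((2 ^ (a - 1) : ℝ) : ℂ) * (Gamma (a / 2 + I * s) * Gamma (a / 2 - I * s)) / Gamma a := by
  have h := betaIntegral_eq_Gamma_mul_div (a / 2 + I * s) (a / 2 - I * s)
    (by simp [ha]) (by simp [ha])
  rw [show (a / 2 + I * s : ℂ) + (a / 2 - I * s) = a by ring] at h
  rw [betaIntegral, intervalIntegral.integral_of_le zero_le_one, integral_Ioc_eq_integral_Ioo,
    ← image_logistic_univ,
    integral_image_eq_integral_deriv_smul_of_monotoneOn MeasurableSet.univ
      (fun u _ => (hasDerivAt_logistic u).hasDerivWithinAt) monotone_logistic] at h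
  simp only [logistic_integrand] at h
  rw [Measure.restrict_univ, integral_const_mul] at h
  have h0 : ((2 ^ (a - 1) : ℝ) : ℂ) * ((2 ^ (1 - a) : ℝ) : ℂ) = 1 := by
    rw [← ofReal_mul, ← Real.rpow_add two_pos]; simp
  rw [mul_div_assoc, ← h, ← mul_assoc, h0, one_mul]

/-! ### The half-line Fourier transform of a power of `sinh` -/

/-- The substitution `y = 1 - e ^ (-2 w)` maps the half-line onto `(0, 1)`; it turns the Beta
integral with parameters `1 - a` and `a / 2 - i s` into the half-line Fourier transform of
`sinh ^ (-a)`. -/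
theorem image_one_sub_exp_Ioi : (fun w : ℝ => 1 - Real.exp (-2 * w)) '' Ioi 0 = Ioo 0 1 := by
  ext y
  constructor
  · rintro ⟨w, hw, rfl⟩
    have hw : 0 < w := hw
    exact ⟨sub_pos.2 (Real.exp_lt_one_iff.2 (by linarith)), sub_lt_self _ (Real.exp_pos _)⟩
  · rintro ⟨h0, h1⟩
    refine ⟨-Real.log (1 - y) / 2, ?_, ?_⟩
    · have := Real.log_neg (show 0 < 1 - y by linarith) (by linarith)
      exact mem_Ioi.2 (by linarith)
    · have : -2 * (-Real.log (1 - y) / 2) = Real.log (1 - y) := by ring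
      simp only [this]
      rw [Real.exp_log (by linarith)]
      ring

theorem hasDerivAt_one_sub_exp (w : ℝ) :
    HasDerivAt (fun w : ℝ => 1 - Real.exp (-2 * w)) (2 * Real.exp (-2 * w)) w := by
  have h := (((hasDerivAt_id w).const_mul (-2)).exp).const_sub 1
  refine h.congr_deriv ?_
  simp only [id]
  ring

theorem monotone_one_sub_exp : MonotoneOn (fun w : ℝ => 1 - Real.exp (-2 * w)) (Ioi 0) := by
  intro x _ y _ h
  simp only
  gcongr 1 - Real.exp ?_
  linarith

theorem one_sub_exp_integrand (a s : ℝ) {w : ℝ} (hw : w ∈ Ioi (0 : ℝ)) :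
    (2 * Real.exp (-2 * w) : ℝ) •
      (((1 - Real.exp (-2 * w) : ℝ) : ℂ) ^ ((1 - a : ℂ) - 1)
        * (1 - ((1 - Real.exp (-2 * w) : ℝ) : ℂ)) ^ ((a / 2 - I * s : ℂ) - 1))
    = ((2 ^ (1 - a) : ℝ) : ℂ) * (((Real.sinh w) ^ (-a) : ℝ) * cexp (2 * I * s * w)) := by
  have hs : 0 < Real.sinh w := Real.sinh_pos_iff.2 hw
  have h1 : 1 - ((1 - Real.exp (-2 * w) : ℝ) : ℂ) = ((Real.exp (-2 * w) : ℝ) : ℂ) := by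
    push_cast; ring
  have h2 : 1 - Real.exp (-2 * w) = 2 * Real.sinh w * Real.exp (-w) := by
    have : Real.exp w * Real.exp (-w) = 1 := by rw [← Real.exp_add]; simp
    rw [Real.sinh_eq, show -2 * w = -w + -w by ring, Real.exp_add]
    linear_combination -this
  have h3 : 0 < 1 - Real.exp (-2 * w) := by rw [h2]; positivity
  have h4 : Real.log (1 - Real.exp (-2 * w)) = Real.log 2 + Real.log (Real.sinh w) - w := by
    rw [h2, Real.log_mul (by positivity) (Real.exp_pos _).ne', Real.log_exp,
      Real.log_mul (by norm_num) hs.ne']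
    ring
  have h5 : (2 * Real.exp (-2 * w) : ℝ) = Real.exp (Real.log 2 - 2 * w) := by
    rw [sub_eq_add_neg, Real.exp_add, Real.exp_log two_pos]
    ring_nf
  rw [h1, cpow_def_of_ne_zero (ofReal_ne_zero.2 h3.ne'),
    cpow_def_of_ne_zero (ofReal_ne_zero.2 (Real.exp_pos _).ne'), ← ofReal_log h3.le,
    ← ofReal_log (Real.exp_pos _).le, h4, Real.log_exp, Real.rpow_def_of_pos hs,
    Real.rpow_def_of_pos two_pos, h5, real_smul]
  push_cast
  simp only [← Complex.exp_add]
  congr 1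
  ring

theorem integrableOn_sinh_rpow {a : ℝ} (ha : 0 < a) (ha1 : a < 1) :
    IntegrableOn (fun w : ℝ => Real.sinh w ^ (-a)) (Ioi 0) := by
  have h := betaIntegral_convergent (u := 1 - a) (v := a / 2 - I * (0 : ℝ))
    (by simp [ha1]) (by simp [ha])
  rw [intervalIntegrable_iff_integrableOn_Ioo_of_le zero_le_one, ← image_one_sub_exp_Ioi,
    integrableOn_image_iff_integrableOn_deriv_smul_of_monotoneOn measurableSet_Ioi
      (fun w _ => (hasDerivAt_one_sub_exp w).hasDerivWithinAt) monotone_one_sub_exp,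
    integrableOn_congr_fun (fun w hw => one_sub_exp_integrand a 0 hw) measurableSet_Ioi] at h
  have h2 := (h.const_mul ((2 ^ (1 - a) : ℝ) : ℂ)⁻¹).re
  refine h2.congr (ae_of_all _ fun u => ?_)
  have h0 : ((2 ^ (1 - a) : ℝ) : ℂ) ≠ 0 := ofReal_ne_zero.2 (by positivity)
  simp only [inv_mul_cancel_left₀ h0]
  simp

theorem integral_sinh_rpow {a : ℝ} (ha : 0 < a) (ha1 : a < 1) (s : ℝ) :
    ∫ w in Ioi (0 : ℝ), ((Real.sinh w ^ (-a) : ℝ) : ℂ) * cexp (2 * I * s * w)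
      = ((2 ^ (a - 1) : ℝ) : ℂ) * (Gamma (1 - a) * Gamma (a / 2 - I * s))
          / Gamma (1 - a / 2 - I * s) := by
  have h := betaIntegral_eq_Gamma_mul_div (1 - a) (a / 2 - I * s)
    (by simp [ha1]) (by simp [ha])
  rw [show (1 - a : ℂ) + (a / 2 - I * s) = 1 - a / 2 - I * s by ring] at h
  rw [betaIntegral, intervalIntegral.integral_of_le zero_le_one, integral_Ioc_eq_integral_Ioo,
    ← image_one_sub_exp_Ioi,
    integral_image_eq_integral_deriv_smul_of_monotoneOn measurableSet_Ioi
      (fun w _ => (hasDerivAt_one_sub_exp w).hasDerivWithinAt) monotone_one_sub_exp,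
    setIntegral_congr_fun measurableSet_Ioi (fun w hw => one_sub_exp_integrand a s hw),
    integral_const_mul] at h
  have h0 : ((2 ^ (a - 1) : ℝ) : ℂ) * ((2 ^ (1 - a) : ℝ) : ℂ) = 1 := by
    rw [← ofReal_mul, ← Real.rpow_add two_pos]; simp
  rw [mul_div_assoc, ← h, ← mul_assoc, h0, one_mul]

/-- The half-line transform of `sinh ^ (-a)`, rewritten with the reflection formula so that it
contains the same Gamma quotient as `integral_cosh_rpow`. Its real and imaginary parts are then
visible: the Gamma quotient is real. -/
theorem integral_sinh_rpow' {a : ℝ} (ha : 0 < a) (ha1 : a < 1) (s : ℝ) :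
    ∫ w in Ioi (0 : ℝ), ((Real.sinh w ^ (-a) : ℝ) : ℂ) * cexp (2 * I * s * w)
      = ((2 ^ (a - 2) : ℝ) : ℂ) * (Gamma (a / 2 + I * s) * Gamma (a / 2 - I * s)) / Gamma a
        * (Real.cosh (Real.pi * s) / Real.cos (Real.pi * a / 2)
          + I * (Real.sinh (Real.pi * s) / Real.sin (Real.pi * a / 2))) := by
  have hpi := Real.pi_pos
  have hG : ∀ z : ℂ, 0 < z.re → Gamma z ≠ 0 := fun z hz => Gamma_ne_zero_of_re_pos hz
  have h1 := Gamma_mul_Gamma_one_sub (a / 2 + I * s)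
  have h2 := Gamma_mul_Gamma_one_sub a
  have h3 : Gamma (1 - a / 2 - I * s) ≠ 0 := hG _ (by simp; linarith)
  have h4 : Gamma (a : ℂ) ≠ 0 := hG _ (by simpa)
  have hc : 0 < Real.cos (Real.pi * a / 2) :=
    Real.cos_pos_of_mem_Ioo ⟨by nlinarith, by nlinarith⟩
  have hs : 0 < Real.sin (Real.pi * a / 2) :=
    Real.sin_pos_of_pos_of_lt_pi (by positivity) (by nlinarith)
  have hc' : (Real.cos (Real.pi * a / 2) : ℂ) ≠ 0 := ofReal_ne_zero.2 hc.ne'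
  have hs' : (Real.sin (Real.pi * a / 2) : ℂ) ≠ 0 := ofReal_ne_zero.2 hs.ne'
  have hpi' : (Real.pi : ℂ) ≠ 0 := ofReal_ne_zero.2 hpi.ne'
  have h5 : sin (Real.pi * a) = 2 * Real.sin (Real.pi * a / 2) * Real.cos (Real.pi * a / 2) := by
    push_cast
    rw [← sin_two_mul]
    ring_nf
  have h6 : sin (Real.pi * (a / 2 + I * s)) = Real.sin (Real.pi * a / 2) * Real.cosh (Real.pi * s)
      + Real.cos (Real.pi * a / 2) * Real.sinh (Real.pi * s) * I := by
    push_cast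
    rw [mul_assoc (cos _), ← sin_mul_I, ← cos_mul_I, ← sin_add]
    ring_nf
  have h7 : sin (Real.pi * (a / 2 + I * s)) ≠ 0 := by
    intro h
    rw [h, div_zero, mul_eq_zero] at h1
    rcases h1 with h1 | h1
    · exact hG _ (by simp [ha]) h1
    · exact h3 (by rw [← h1]; ring_nf)
  have h8 : ((2 ^ (a - 1) : ℝ) : ℂ) = 2 * ((2 ^ (a - 2) : ℝ) : ℂ) := by
    rw [show a - 1 = 1 + (a - 2) by ring, Real.rpow_add two_pos]
    push_cast
    simp
  rw [integral_sinh_rpow ha ha1, h8]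
  rw [show 1 - ((a : ℂ) / 2 + I * s) = 1 - a / 2 - I * s by ring, eq_div_iff h7] at h1
  rw [eq_div_iff (by rw [h5]; exact mul_ne_zero (mul_ne_zero two_ne_zero hs') hc'), h5] at h2
  rw [h6] at h1
  have h9 : (Real.cosh (Real.pi * s) / Real.cos (Real.pi * a / 2)
      + I * (Real.sinh (Real.pi * s) / Real.sin (Real.pi * a / 2)) : ℂ)
      = (Real.sin (Real.pi * a / 2) * Real.cosh (Real.pi * s)
      + Real.cos (Real.pi * a / 2) * Real.sinh (Real.pi * s) * I)
        / (Real.sin (Real.pi * a / 2) * Real.cos (Real.pi * a / 2)) := by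
    field_simp
  rw [h9, div_mul_div_comm, div_eq_div_iff h3 (mul_ne_zero h4 (mul_ne_zero hs' hc'))]
  linear_combination ((2 ^ (a - 2) : ℝ) : ℂ) * Gamma (a / 2 - I * s) * (h2 - h1)

/-! ### Differentiating Gamma quotients in the exponent -/

theorem abs_log_le_rpow_add_rpow {x ε : ℝ} (hx : 0 < x) (hε : 0 < ε) :
    |Real.log x| ≤ (x ^ ε + x ^ (-ε)) / ε := by
  have h1 := Real.log_le_rpow_div hx.le hε
  have h2 := Real.log_le_rpow_div (inv_pos.2 hx).le hε
  rw [Real.log_inv, Real.inv_rpow hx.le, ← Real.rpow_neg hx.le] at h2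
  have h3 : 0 < x ^ ε / ε := by positivity
  have h4 : 0 < x ^ (-ε) / ε := by positivity
  rw [add_div, abs_le]
  constructor <;> linarith

/-- Two functions that agree to the left of `x` and are differentiable at `x` have the same
derivative there. The `sinh` integrals below have a closed form only for exponents `a < 1`, but are
differentiable at `a = 1`, which is where the derivative is needed. -/
theorem hasDerivAt_eq_of_eventuallyEq_left {f g : ℝ → ℂ} {f' g' : ℂ} {x : ℝ}
    (hf : HasDerivAt f f' x) (hg : HasDerivAt g g' x) (h : f =ᶠ[𝓝[<] x] g) : f' = g' := by
  have h1 : f x = g x :=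
    tendsto_nhds_unique ((hf.continuousAt.tendsto.mono_left nhdsWithin_le_nhds).congr' h)
      (hg.continuousAt.tendsto.mono_left nhdsWithin_le_nhds)
  exact (uniqueDiffWithinAt_Iio x).eq_deriv _
    (hf.hasDerivWithinAt.congr_of_eventuallyEq h.symm h1.symm) hg.hasDerivWithinAt

/-- The reflection formula on the line `Re z = 1 / 2`, in the shape in which the exponent `a = 1`
enters. -/
theorem gammaProduct_one (s : ℝ) :
    Gamma (((1 : ℝ) : ℂ) / 2 + I * s) * Gamma (((1 : ℝ) : ℂ) / 2 - I * s)
      = Real.pi / Real.cosh (Real.pi * s) := by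
  have h := Gamma_mul_Gamma_one_sub (1 / 2 + I * s)
  rw [show (1 : ℂ) - (1 / 2 + I * s) = 1 / 2 - I * s by ring,
    show (Real.pi : ℂ) * (1 / 2 + I * s) = (Real.pi * s) * I + Real.pi / 2 by ring,
    sin_add_pi_div_two, cos_mul_I] at h
  rw [ofReal_one, h]
  push_cast
  rfl

/-- The function `log 2 + γ + (ψ(1/2 + i s) + ψ(1/2 - i s)) / 2`: the logarithmic derivative at
`a = 1` of `2 ^ (a - 1) Γ(a / 2 + i s) Γ(a / 2 - i s) / Γ(a)`, see `hasDerivAt_gammaQuotient`. -/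
noncomputable def shiftedDigamma (s : ℝ) : ℂ :=
  (Real.log 2 : ℂ) + Real.eulerMascheroniConstant + digammaSum s / 2

theorem half_add_ne (s : ℝ) (m : ℕ) : (1 / 2 + I * s : ℂ) ≠ -m := by
  intro h
  have := congrArg Complex.re h
  simp at this
  have h2 : (0 : ℝ) ≤ m := Nat.cast_nonneg m
  linarith

theorem half_sub_ne (s : ℝ) (m : ℕ) : (1 / 2 - I * s : ℂ) ≠ -m := by
  have := half_add_ne (-s) m
  push_cast at this
  rwa [mul_neg, ← sub_eq_add_neg] at this

theorem hasDerivAt_Gamma_digamma {z : ℂ} (hz : ∀ m : ℕ, z ≠ -m) :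
    HasDerivAt Gamma (Gamma z * digamma z) z := by
  have := (differentiableAt_Gamma z hz).hasDerivAt
  rwa [digamma_def, logDeriv_apply, mul_div_cancel₀ _ (Gamma_ne_zero hz)]

theorem hasDerivAt_gammaQuotient (s : ℝ) :
    HasDerivAt (fun a : ℝ => ((2 ^ (a - 1) : ℝ) : ℂ)
        * (Gamma (a / 2 + I * s) * Gamma (a / 2 - I * s)) / Gamma a)
      (Real.pi / Real.cosh (Real.pi * s) * shiftedDigamma s) 1 := by
  have e1 : HasDerivAt (fun a : ℝ => (a / 2 + I * s : ℂ)) (1 / 2) 1 :=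
    ((hasDerivAt_id (1 : ℝ)).ofReal_comp.div_const 2).add_const _
  have e2 : HasDerivAt (fun a : ℝ => (a / 2 - I * s : ℂ)) (1 / 2) 1 :=
    ((hasDerivAt_id (1 : ℝ)).ofReal_comp.div_const 2).sub_const _
  have g1 := HasDerivAt.comp (1 : ℝ) (h₂ := Gamma)
    (hasDerivAt_Gamma_digamma (by simpa using half_add_ne s)) e1
  have g2 := HasDerivAt.comp (1 : ℝ) (h₂ := Gamma)
    (hasDerivAt_Gamma_digamma (by simpa using half_sub_ne s)) e2
  have g3 := HasDerivAt.comp (1 : ℝ) (h₂ := Gamma)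
    (by simpa using hasDerivAt_Gamma_one) (hasDerivAt_id (1 : ℝ)).ofReal_comp
  have g4 : HasDerivAt (fun a : ℝ => ((2 ^ (a - 1) : ℝ) : ℂ)) (Real.log 2) 1 := by
    have := (((hasDerivAt_id (1 : ℝ)).sub_const 1).const_rpow two_pos).ofReal_comp
    simpa using this
  have h := (g4.mul (g1.mul g2)).div g3 (by simp)
  refine h.congr_deriv ?_
  rw [shiftedDigamma, digammaSum]
  have := gammaProduct_one s
  simp only [Pi.mul_apply, Function.comp_apply, id, sub_self, Real.rpow_zero, ofReal_one,
    Gamma_one] at this ⊢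
  rw [← this]
  ring

/-! ### Fourier transforms of `1 / cosh`, `1 / cosh ^ 2` and `log cosh / cosh` -/

/-- The dominating function for differentiation of `cosh ^ (-a)` in the exponent, for
`a > 1 / 2`. -/
theorem integrable_log_cosh : Integrable fun u : ℝ =>
    Real.log (Real.cosh u) * Real.cosh u ^ (-(1 / 2) : ℝ) := by
  refine ((integrable_cosh_rpow (a := 1 / 4) (by norm_num)).const_mul 4).mono'
    (Measurable.aestronglyMeasurable (by fun_prop)) (ae_of_all _ fun u => ?_)
  have h1 := Real.one_le_cosh u
  have h0 := Real.cosh_pos u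
  have h2 := Real.log_le_rpow_div h0.le (show (0 : ℝ) < 1 / 4 by norm_num)
  rw [Real.norm_eq_abs, abs_of_nonneg (mul_nonneg (Real.log_nonneg h1) (by positivity))]
  calc _ ≤ Real.cosh u ^ (1 / 4 : ℝ) / (1 / 4) * Real.cosh u ^ (-(1 / 2) : ℝ) := by gcongr
    _ = 4 * (Real.cosh u ^ (1 / 4 : ℝ) * Real.cosh u ^ (-(1 / 2) : ℝ)) := by ring
    _ = _ := by rw [← Real.rpow_add h0]; norm_num

theorem norm_exp_two_I (s u : ℝ) : ‖cexp (2 * I * s * u)‖ = 1 := by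
  rw [show 2 * I * (s : ℂ) * u = ((2 * s * u : ℝ) : ℂ) * I by push_cast; ring]
  exact norm_exp_ofReal_mul_I _

theorem hasDerivAt_rpow_neg {y : ℝ} (hy : 0 < y) (a : ℝ) :
    HasDerivAt (fun a : ℝ => y ^ (-a)) (-(Real.log y * y ^ (-a))) a := by
  have := ((hasDerivAt_id a).neg).const_rpow hy
  exact this.congr_deriv (by rw [Pi.neg_apply, id]; ring)

/-- The derivative at `a = 1` of `integral_cosh_rpow`. -/
theorem integral_log_cosh (s : ℝ) :
    ∫ u : ℝ, ((Real.log (Real.cosh u) * (Real.cosh u)⁻¹ : ℝ) : ℂ) * cexp (2 * I * s * u)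
      = -(Real.pi / Real.cosh (Real.pi * s) * shiftedDigamma s) := by
  have key := hasDerivAt_integral_of_dominated_loc_of_deriv_le (𝕜 := ℝ) (x₀ := (1 : ℝ))
    (μ := volume)
    (F := fun a (u : ℝ) => ((Real.cosh u ^ (-a) : ℝ) : ℂ) * cexp (2 * I * s * u))
    (F' := fun a (u : ℝ) => ((-(Real.log (Real.cosh u) * Real.cosh u ^ (-a)) : ℝ) : ℂ)
      * cexp (2 * I * s * u))
    (bound := fun u => Real.log (Real.cosh u) * Real.cosh u ^ (-(1 / 2) : ℝ))
    (Ioi_mem_nhds (show (1 / 2 : ℝ) < 1 by norm_num))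
    (Eventually.of_forall fun a => Measurable.aestronglyMeasurable (by fun_prop))
    ?_ (Measurable.aestronglyMeasurable (by fun_prop)) (ae_of_all _ fun u a ha => ?_)
    integrable_log_cosh (ae_of_all _ fun u a ha => ?_)
  · have h2 : (fun a : ℝ => ∫ u : ℝ, ((Real.cosh u ^ (-a) : ℝ) : ℂ) * cexp (2 * I * s * u))
        =ᶠ[𝓝 1] fun a : ℝ => ((2 ^ (a - 1) : ℝ) : ℂ)
          * (Gamma (a / 2 + I * s) * Gamma (a / 2 - I * s)) / Gamma a := by
      filter_upwards [Ioi_mem_nhds (show (0 : ℝ) < 1 by norm_num)] with a ha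
      exact integral_cosh_rpow ha s
    have h3 := (key.2.congr_of_eventuallyEq h2.symm).unique (hasDerivAt_gammaQuotient s)
    rw [← h3, ← integral_neg]
    refine integral_congr_ae (ae_of_all _ fun u => ?_)
    simp only [Real.rpow_neg_one]
    push_cast
    ring
  · refine (integrable_cosh_rpow (a := 1) one_pos).mono'
      (Measurable.aestronglyMeasurable (by fun_prop)) (ae_of_all _ fun u => ?_)
    rw [norm_mul, norm_exp_two_I, mul_one, norm_real, Real.norm_eq_abs,
      abs_of_nonneg (Real.rpow_nonneg (Real.cosh_pos u).le _)]
  · have h0 := Real.cosh_pos u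
    have h1 := Real.one_le_cosh u
    rw [norm_mul, norm_exp_two_I, mul_one, norm_real, norm_neg, Real.norm_eq_abs,
      abs_of_nonneg (mul_nonneg (Real.log_nonneg h1) (by positivity))]
    have := Real.log_nonneg h1
    have ha : (1 / 2 : ℝ) < a := ha
    gcongr
  · exact (hasDerivAt_rpow_neg (Real.cosh_pos u) a).ofReal_comp.mul_const _

theorem integral_inv_cosh (s : ℝ) :
    ∫ u : ℝ, (((Real.cosh u)⁻¹ : ℝ) : ℂ) * cexp (2 * I * s * u)
      = Real.pi / Real.cosh (Real.pi * s) := by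
  have := integral_cosh_rpow one_pos s
  rw [gammaProduct_one] at this
  simpa only [Real.rpow_neg_one, sub_self, Real.rpow_zero, ofReal_one, one_mul, Gamma_one,
    div_one] using this

theorem integral_inv_cosh_sq {r : ℝ} (hr : r ≠ 0) :
    ∫ u : ℝ, (((Real.cosh u ^ 2)⁻¹ : ℝ) : ℂ) * cexp (2 * I * r * u)
      = 2 * Real.pi * r / Real.sinh (Real.pi * r) := by
  have := integral_cosh_rpow two_pos r
  have hz : I * (r : ℂ) ≠ 0 := mul_ne_zero I_ne_zero (ofReal_ne_zero.2 hr)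
  have h1 := Gamma_mul_Gamma_one_sub (I * r)
  have h2 : Gamma (((2 : ℝ) : ℂ) / 2 + I * r) * Gamma (((2 : ℝ) : ℂ) / 2 - I * r)
      = Real.pi * r / Real.sinh (Real.pi * r) := by
    have : ((2 : ℝ) : ℂ) / 2 = 1 := by norm_num
    rw [this, add_comm, Gamma_add_one _ hz, mul_assoc, h1,
      show (Real.pi : ℂ) * (I * r) = (Real.pi * r) * I by ring, sin_mul_I]
    push_cast
    rw [mul_comm (sinh _), ← mul_div_assoc, mul_assoc, mul_div_mul_left _ _ I_ne_zero,
      mul_comm (r : ℂ)]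
  rw [h2] at this
  have h3 : ∀ u : ℝ, Real.cosh u ^ (-2 : ℝ) = (Real.cosh u ^ 2)⁻¹ := fun u => by
    rw [Real.rpow_neg (Real.cosh_pos u).le, Real.rpow_two]
  simp only [h3] at this
  rw [this, show (2 : ℝ) - 1 = 1 by norm_num, Real.rpow_one, ofReal_ofNat, Gamma_ofNat_eq_factorial]
  norm_num
  ring

/-! ### The half-line integrals of `log sinh / sinh` -/

/-- Differentiation of `∫ sinh ^ (-a) φ` under the integral sign at `a = 1`. The zero of `φ` at the
origin makes the integral converge beyond `a = 1`. -/
theorem hasDerivAt_integral_sinh_rpow {φ : ℝ → ℝ} {A : ℝ} (hφ : Continuous φ)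
    (h1 : ∀ w, |φ w| ≤ A) (h2 : ∀ w, 0 < w → |φ w| ≤ A * w) :
    IntegrableOn (fun w => Real.log (Real.sinh w) * (Real.sinh w)⁻¹ * φ w) (Ioi 0) ∧
    HasDerivAt (fun a : ℝ => ∫ w in Ioi 0, Real.sinh w ^ (-a) * φ w)
      (-∫ w in Ioi 0, Real.log (Real.sinh w) * (Real.sinh w)⁻¹ * φ w) 1 := by
  have hA : 0 ≤ A := (abs_nonneg _).trans (h1 0)
  have hb : ∀ w : ℝ, 0 < w → ∀ a : ℝ, 1 / 2 < a → a < 3 / 2 →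
      Real.sinh w ^ (-a) * |φ w| ≤ A * Real.sinh w ^ (-(1 / 2) : ℝ) := by
    intro w hw a ha ha'
    have hs : 0 < Real.sinh w := Real.sinh_pos_iff.2 hw
    rcases le_total 1 (Real.sinh w) with h | h
    · calc Real.sinh w ^ (-a) * |φ w| ≤ Real.sinh w ^ (-(1 / 2) : ℝ) * A := by
            have := h1 w
            gcongr
        _ = _ := mul_comm _ _
    · calc Real.sinh w ^ (-a) * |φ w| ≤ Real.sinh w ^ (-a) * (A * Real.sinh w) := by
            gcongr
            exact (h2 w hw).trans (by gcongr; exact Real.self_le_sinh_iff.2 hw.le)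
        _ = A * (Real.sinh w ^ (-a) * Real.sinh w ^ (1 : ℝ)) := by rw [Real.rpow_one]; ring
        _ = A * Real.sinh w ^ (1 - a) := by rw [← Real.rpow_add hs]; ring_nf
        _ ≤ _ := by
            gcongr A * ?_
            exact Real.rpow_le_rpow_of_exponent_ge hs h (by linarith)
  have hint : IntegrableOn (fun w => Real.sinh w ^ (-1 : ℝ) * φ w) (Ioi 0) := by
    refine ((integrableOn_sinh_rpow (a := 1 / 2) (by norm_num) (by norm_num)).const_mul A).mono'
      (Measurable.aestronglyMeasurable (by fun_prop))
      ((ae_restrict_iff' measurableSet_Ioi).2 (ae_of_all _ fun w hw => ?_))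
    have hs : 0 < Real.sinh w := Real.sinh_pos_iff.2 hw
    rw [Real.norm_eq_abs, abs_mul, abs_of_pos (Real.rpow_pos_of_pos hs _)]
    exact hb w hw 1 (by norm_num) (by norm_num)
  have key := hasDerivAt_integral_of_dominated_loc_of_deriv_le (𝕜 := ℝ) (x₀ := (1 : ℝ))
    (μ := volume.restrict (Ioi (0 : ℝ)))
    (F := fun a (w : ℝ) => Real.sinh w ^ (-a) * φ w)
    (F' := fun a (w : ℝ) => -(Real.log (Real.sinh w) * Real.sinh w ^ (-a)) * φ w)
    (bound := fun w => 4 * A * (Real.sinh w ^ (-(1 / 4) : ℝ) + Real.sinh w ^ (-(3 / 4) : ℝ)))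
    (s := Ioo (1 / 2) (3 / 2))
    (Ioo_mem_nhds (by norm_num) (by norm_num))
    (Eventually.of_forall fun a => Measurable.aestronglyMeasurable (by fun_prop))
    hint (Measurable.aestronglyMeasurable (by fun_prop))
    ((ae_restrict_iff' measurableSet_Ioi).2 (ae_of_all _ fun w hw a ha => ?_))
    (((integrableOn_sinh_rpow (a := 1 / 4) (by norm_num) (by norm_num)).add
      (integrableOn_sinh_rpow (a := 3 / 4) (by norm_num) (by norm_num))).const_mul (4 * A))
    ((ae_restrict_iff' measurableSet_Ioi).2 (ae_of_all _ fun w hw a ha => ?_))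
  · constructor
    · refine key.1.neg.congr (ae_of_all _ fun w => ?_)
      simp only [Pi.neg_apply, Real.rpow_neg_one]
      ring
    · refine key.2.congr_deriv ?_
      rw [← integral_neg]
      refine integral_congr_ae (ae_of_all _ fun w => ?_)
      simp only [Real.rpow_neg_one]
      ring
  · have hs : 0 < Real.sinh w := Real.sinh_pos_iff.2 hw
    rw [Real.norm_eq_abs, abs_mul, abs_neg, abs_mul, abs_of_pos (Real.rpow_pos_of_pos hs _)]
    have h4 := abs_log_le_rpow_add_rpow hs (show (0 : ℝ) < 1 / 4 by norm_num)
    calc _ = |Real.log (Real.sinh w)| * (Real.sinh w ^ (-a) * |φ w|) := by ring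
      _ ≤ ((Real.sinh w ^ (1 / 4 : ℝ) + Real.sinh w ^ (-(1 / 4) : ℝ)) / (1 / 4))
          * (A * Real.sinh w ^ (-(1 / 2) : ℝ)) := by
          gcongr ?_ * ?_
          exact hb w hw a ha.1 ha.2
      _ = 4 * A * (Real.sinh w ^ (1 / 4 : ℝ) * Real.sinh w ^ (-(1 / 2) : ℝ)
          + Real.sinh w ^ (-(1 / 4) : ℝ) * Real.sinh w ^ (-(1 / 2) : ℝ)) := by ring
      _ = _ := by rw [← Real.rpow_add hs, ← Real.rpow_add hs]; norm_num
  · exact (hasDerivAt_rpow_neg (Real.sinh_pos_iff.2 hw) a).mul_const _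

/-- The cosine and sine transforms of `sinh ^ (-a)`. The trigonometric factors are kept on the left
so that both sides are differentiable at `a = 1`, where `cos (π a / 2)` vanishes. -/
theorem integral_sinh_rpow_cos_sin {a : ℝ} (ha : 0 < a) (ha1 : a < 1) (s : ℝ) :
    ((∫ w in Ioi (0 : ℝ), Real.sinh w ^ (-a) * Real.cos (2 * s * w) : ℝ) : ℂ)
        * (2 * Real.cos (Real.pi * a / 2))
      = ((2 ^ (a - 1) : ℝ) : ℂ) * (Gamma (a / 2 + I * s) * Gamma (a / 2 - I * s)) / Gamma a
        * Real.cosh (Real.pi * s) ∧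
    ((∫ w in Ioi (0 : ℝ), Real.sinh w ^ (-a) * Real.sin (2 * s * w) : ℝ) : ℂ)
        * (2 * Real.sin (Real.pi * a / 2))
      = ((2 ^ (a - 1) : ℝ) : ℂ) * (Gamma (a / 2 + I * s) * Gamma (a / 2 - I * s)) / Gamma a
        * Real.sinh (Real.pi * s) := by
  have hint : ∀ s : ℝ, IntegrableOn
      (fun w : ℝ => ((Real.sinh w ^ (-a) : ℝ) : ℂ) * cexp (2 * I * s * w)) (Ioi 0) := by
    intro s
    refine (integrableOn_sinh_rpow ha ha1).mono' (Measurable.aestronglyMeasurable (by fun_prop))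
      ((ae_restrict_iff' measurableSet_Ioi).2 (ae_of_all _ fun w hw => ?_))
    rw [norm_mul, norm_exp_two_I, mul_one, norm_real, Real.norm_eq_abs,
      abs_of_pos (Real.rpow_pos_of_pos (Real.sinh_pos_iff.2 hw) _)]
  have hpi := Real.pi_pos
  have hc : (Real.cos (Real.pi * a / 2) : ℂ) ≠ 0 := ofReal_ne_zero.2
    (Real.cos_pos_of_mem_Ioo ⟨by nlinarith, by nlinarith⟩).ne'
  have hs : (Real.sin (Real.pi * a / 2) : ℂ) ≠ 0 := ofReal_ne_zero.2
    (Real.sin_pos_of_pos_of_lt_pi (by positivity) (by nlinarith)).ne'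
  have h8 : ((2 ^ (a - 1) : ℝ) : ℂ) = 2 * ((2 ^ (a - 2) : ℝ) : ℂ) := by
    rw [show a - 1 = 1 + (a - 2) by ring, Real.rpow_add two_pos]
    push_cast
    simp
  have e1 := integral_sinh_rpow' ha ha1 s
  have e2 := integral_sinh_rpow' ha ha1 (-s)
  rw [ofReal_neg, mul_neg, mul_neg I, sub_neg_eq_add, ← sub_eq_add_neg, mul_neg,
    Real.cosh_neg, Real.sinh_neg, mul_comm (Gamma _)] at e2
  constructor
  · have h : ((∫ w in Ioi (0 : ℝ), Real.sinh w ^ (-a) * Real.cos (2 * s * w) : ℝ) : ℂ)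
        = ((∫ w in Ioi (0 : ℝ), ((Real.sinh w ^ (-a) : ℝ) : ℂ) * cexp (2 * I * s * w))
          + (∫ w in Ioi (0 : ℝ), ((Real.sinh w ^ (-a) : ℝ) : ℂ)
            * cexp (2 * I * (-s : ℝ) * w))) / 2 := by
      rw [← integral_add (hint s) (hint (-s)), ← integral_div, ← integral_complex_ofReal]
      refine integral_congr_ae (ae_of_all _ fun w => ?_)
      push_cast
      rw [cos]
      ring_nf
    rw [h, e1, ofReal_neg, mul_neg, e2, h8, ofReal_neg (Real.sinh _)]
    generalize (Real.cos (Real.pi * a / 2) : ℂ) = C at hc ⊢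
    generalize (Real.sin (Real.pi * a / 2) : ℂ) = S at hs ⊢
    field_simp
    ring
  · have h : ((∫ w in Ioi (0 : ℝ), Real.sinh w ^ (-a) * Real.sin (2 * s * w) : ℝ) : ℂ)
        = ((∫ w in Ioi (0 : ℝ), ((Real.sinh w ^ (-a) : ℝ) : ℂ) * cexp (2 * I * s * w))
          - (∫ w in Ioi (0 : ℝ), ((Real.sinh w ^ (-a) : ℝ) : ℂ)
            * cexp (2 * I * (-s : ℝ) * w))) / (2 * I) := by
      rw [← integral_sub (hint s) (hint (-s)), ← integral_div, ← integral_complex_ofReal]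
      refine integral_congr_ae (ae_of_all _ fun w => ?_)
      push_cast
      rw [sin]
      field_simp
      rw [I_sq]
      ring_nf
    rw [h, e1, ofReal_neg, mul_neg, e2, h8, ofReal_neg (Real.sinh _)]
    generalize (Real.cos (Real.pi * a / 2) : ℂ) = C at hc ⊢
    generalize (Real.sin (Real.pi * a / 2) : ℂ) = S at hs ⊢
    field_simp
    ring

theorem abs_sin_le_self_mul {x w : ℝ} (hw : 0 < w) : |Real.sin (x * w)| ≤ |x| * w := by
  refine Real.abs_sin_le_abs.trans ?_
  rw [abs_mul, abs_of_pos hw]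

/-- The derivative at `a = 1` of the sine transform of `sinh ^ (-a)`; the factor `sin (π a / 2)` is
stationary there. -/
theorem integral_log_sinh_mul_sin (s : ℝ) :
    ((∫ w in Ioi (0 : ℝ), Real.log (Real.sinh w) * (Real.sinh w)⁻¹ * Real.sin (2 * s * w) : ℝ) : ℂ)
      = -(Real.pi / 2 * Real.tanh (Real.pi * s) * shiftedDigamma s) := by
  obtain ⟨-, hd⟩ := hasDerivAt_integral_sinh_rpow (φ := fun w => Real.sin (2 * s * w))
    (A := 1 + |2 * s|) (by fun_prop)
    (fun w => (Real.abs_sin_le_one _).trans (by linarith [abs_nonneg (2 * s)]))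
    (fun w hw => (abs_sin_le_self_mul hw).trans (by gcongr; linarith))
  have hsin : HasDerivAt (fun a : ℝ => ((Real.sin (Real.pi * a / 2) : ℝ) : ℂ)) 0 1 := by
    have := ((((hasDerivAt_id (1 : ℝ)).const_mul Real.pi).div_const 2).sin).ofReal_comp
    simpa using this
  have h1 := hd.ofReal_comp.mul (hsin.const_mul 2)
  have h2 := (hasDerivAt_gammaQuotient s).mul_const (Real.sinh (Real.pi * s) : ℂ)
  -- The product of the integral with `2 sin (π a / 2)` is known for `a < 1`.
  have h3 := hasDerivAt_eq_of_eventuallyEq_left h1 h2 ?_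
  · simp only [mul_one, Real.sin_pi_div_two, ofReal_one, mul_zero, add_zero, ofReal_neg] at h3
    rw [Real.tanh_eq_sinh_div_cosh]
    push_cast at h3 ⊢
    linear_combination (-1 / 2) * h3
  · filter_upwards [Ioo_mem_nhdsLT (show (0 : ℝ) < 1 by norm_num)] with a ha
    exact (integral_sinh_rpow_cos_sin ha.1 ha.2 s).2

/-- The derivative at `a = 1` of the difference of two cosine transforms of `sinh ^ (-a)`. Since
`cos (π a / 2)` vanishes at `a = 1`, only its derivative `-π / 2` survives on the left, multiplied
by the value of the integral at `a = 1`, while the right side gives a difference of digamma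
sums. -/
theorem digammaSum_sub (s t : ℝ) :
    digammaSum s - digammaSum t = ((2 * ∫ w in Ioi (0 : ℝ), (Real.sinh w)⁻¹
      * (2 * Real.sin ((s + t) * w) * Real.sin ((s - t) * w)) : ℝ) : ℂ) := by
  have hφ : ∀ w : ℝ, 2 * Real.sin ((s + t) * w) * Real.sin ((s - t) * w)
      = Real.cos (2 * t * w) - Real.cos (2 * s * w) := by
    intro w
    rw [Real.cos_sub_cos, show (2 * t * w + 2 * s * w) / 2 = (s + t) * w by ring,
      show (2 * t * w - 2 * s * w) / 2 = -((s - t) * w) by ring, Real.sin_neg]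
    ring
  obtain ⟨-, hd⟩ := hasDerivAt_integral_sinh_rpow
    (φ := fun w => 2 * Real.sin ((s + t) * w) * Real.sin ((s - t) * w))
    (A := 2 + 2 * |s - t|) (by fun_prop)
    (fun w => by
      rw [abs_mul, abs_mul, abs_two]
      have h1 := Real.abs_sin_le_one ((s + t) * w)
      have h2 := Real.abs_sin_le_one ((s - t) * w)
      calc _ ≤ 2 * 1 * (1 : ℝ) := by gcongr
        _ ≤ _ := by linarith [abs_nonneg (s - t)])
    (fun w hw => by
      rw [abs_mul, abs_mul, abs_two]
      have h1 := Real.abs_sin_le_one ((s + t) * w)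
      have h2 := abs_sin_le_self_mul (x := s - t) hw
      calc _ ≤ 2 * 1 * (|s - t| * w) := by gcongr
        _ ≤ _ := by linarith [abs_nonneg (s - t)])
  have hcos : HasDerivAt (fun a : ℝ => ((Real.cos (Real.pi * a / 2) : ℝ) : ℂ))
      (-(Real.pi / 2)) 1 := by
    have := ((((hasDerivAt_id (1 : ℝ)).const_mul Real.pi).div_const 2).cos).ofReal_comp
    simpa using this
  have h1 := hd.ofReal_comp.mul (hcos.const_mul 2)
  have h2 := ((hasDerivAt_gammaQuotient t).mul_const (Real.cosh (Real.pi * t) : ℂ)).sub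
    ((hasDerivAt_gammaQuotient s).mul_const (Real.cosh (Real.pi * s) : ℂ))
  have h3 := hasDerivAt_eq_of_eventuallyEq_left h1 h2 ?_
  · have hpi : (Real.pi : ℂ) ≠ 0 := ofReal_ne_zero.2 Real.pi_ne_zero
    have hct : (Real.cosh (Real.pi * t) : ℂ) ≠ 0 := ofReal_ne_zero.2 (Real.cosh_pos _).ne'
    have hcs : (Real.cosh (Real.pi * s) : ℂ) ≠ 0 := ofReal_ne_zero.2 (Real.cosh_pos _).ne'
    simp only [mul_one, Real.cos_pi_div_two, ofReal_zero, mul_zero, zero_add,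
      Real.rpow_neg_one] at h3
    rw [mul_right_comm, div_mul_cancel₀ _ hct, mul_right_comm _ _ (Real.cosh (Real.pi * s) : ℂ),
      div_mul_cancel₀ _ hcs, ← mul_sub] at h3
    have h4 : shiftedDigamma s - shiftedDigamma t = (digammaSum s - digammaSum t) / 2 := by
      rw [shiftedDigamma, shiftedDigamma]; ring
    rw [ofReal_mul, ofReal_ofNat]
    refine mul_left_cancel₀ hpi ?_
    linear_combination -2 * Real.pi * h4 + 2 * h3
  · filter_upwards [Ioo_mem_nhdsLT (show (0 : ℝ) < 1 by norm_num)] with a ha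
    have hint : ∀ s : ℝ, IntegrableOn
        (fun w : ℝ => Real.sinh w ^ (-a) * Real.cos (2 * s * w)) (Ioi 0) := by
      intro s
      refine (integrableOn_sinh_rpow ha.1 ha.2).mono'
        (Measurable.aestronglyMeasurable (by fun_prop))
        ((ae_restrict_iff' measurableSet_Ioi).2 (ae_of_all _ fun w hw => ?_))
      have h0 : 0 < Real.sinh w ^ (-a) := Real.rpow_pos_of_pos (Real.sinh_pos_iff.2 hw) _
      rw [Real.norm_eq_abs, abs_mul, abs_of_pos h0]
      exact mul_le_of_le_one_right h0.le (Real.abs_cos_le_one _)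
    simp only [hφ, mul_sub, Pi.mul_apply, Pi.sub_apply]
    rw [integral_sub (hint t) (hint s), ← (integral_sinh_rpow_cos_sin ha.1 ha.2 t).1,
      ← (integral_sinh_rpow_cos_sin ha.1 ha.2 s).1]
    push_cast
    ring

/-! ### Rapidity coordinates -/

theorem hasDerivAt_tanh (u : ℝ) : HasDerivAt Real.tanh (1 / Real.cosh u ^ 2) u := by
  have h := (Real.hasDerivAt_sinh u).div (Real.hasDerivAt_cosh u) (Real.cosh_pos u).ne'
  have h2 : Real.tanh = Real.sinh / Real.cosh := funext Real.tanh_eq_sinh_div_cosh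
  rw [h2]
  refine h.congr_deriv ?_
  congr 1
  linear_combination Real.cosh_sq u

theorem tanh_sub_tanh (u v : ℝ) :
    Real.tanh u - Real.tanh v = Real.sinh (u - v) / (Real.cosh u * Real.cosh v) := by
  rw [Real.tanh_eq_sinh_div_cosh, Real.tanh_eq_sinh_div_cosh, Real.sinh_sub,
    div_sub_div _ _ (Real.cosh_pos u).ne' (Real.cosh_pos v).ne']

/-- In the coordinate `x = ℓ tanh u` the generalised eigenfunction is a plane wave times
`cosh u`. -/
theorem Psi_tanh {ℓ : ℝ} (hℓ : 0 < ℓ) (s u : ℝ) :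
    Psi ℓ s (ℓ * Real.tanh u)
      = ((Real.sqrt (ℓ / Real.pi) / ℓ * Real.cosh u : ℝ) : ℂ) * cexp (-(2 * I * s * u)) := by
  have hc := Real.cosh_pos u
  have h1 : ℓ + ℓ * Real.tanh u = ℓ * Real.exp u / Real.cosh u := by
    rw [Real.tanh_eq_sinh_div_cosh, ← Real.cosh_add_sinh]
    field_simp
  have h2 : ℓ - ℓ * Real.tanh u = ℓ * Real.exp (-u) / Real.cosh u := by
    rw [Real.tanh_eq_sinh_div_cosh, ← Real.cosh_sub_sinh]
    field_simp
  have h3 : ∀ x : ℝ, 0 < ℓ * Real.exp x / Real.cosh u := fun x =>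
    div_pos (mul_pos hℓ (Real.exp_pos _)) hc
  have h4 : ∀ x : ℝ, Real.log (ℓ * Real.exp x / Real.cosh u)
      = Real.log ℓ + x - Real.log (Real.cosh u) := fun x => by
    rw [Real.log_div (by positivity) hc.ne', Real.log_mul hℓ.ne' (Real.exp_pos _).ne', Real.log_exp]
  have h5 : Real.cosh u / ℓ = Real.exp (Real.log (Real.cosh u) - Real.log ℓ) := by
    rw [Real.exp_sub, Real.exp_log hc, Real.exp_log hℓ]
  rw [Psi, h1, h2, cpow_def_of_ne_zero (ofReal_ne_zero.2 (h3 _).ne'),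
    cpow_def_of_ne_zero (ofReal_ne_zero.2 (h3 _).ne'), ← ofReal_log (h3 _).le,
    ← ofReal_log (h3 _).le, h4, h4, div_mul_eq_mul_div, mul_div_assoc, h5, ofReal_mul, mul_assoc,
    mul_assoc, ofReal_exp, ← Complex.exp_add, ← Complex.exp_add]
  congr 2
  push_cast
  ring

/-- The logarithmic kernel in rapidity coordinates `x = ℓ tanh u`, `y = ℓ tanh v`, as a function of
`p = (u, v)`. The weight `1 / (cosh u cosh v)` is what remains of the Jacobian after the factors
`cosh u`, `cosh v` of the two eigenfunctions are taken into account. -/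
noncomputable def rapidityKernel (m ℓ : ℝ) (p : ℝ × ℝ) : ℝ :=
  logTerm m (ℓ * Real.tanh p.1) (ℓ * Real.tanh p.2) * ((Real.cosh p.1)⁻¹ * (Real.cosh p.2)⁻¹)

theorem image_tanh_prod {ℓ : ℝ} (hℓ : 0 < ℓ) :
    Prod.map (fun u => ℓ * Real.tanh u) (fun u => ℓ * Real.tanh u) '' univ
      = Ioo (-ℓ) ℓ ×ˢ Ioo (-ℓ) ℓ := by
  have h : (fun u => ℓ * Real.tanh u) '' univ = Ioo (-ℓ) ℓ := by
    rw [show (fun u => ℓ * Real.tanh u) = (fun x => ℓ * x) ∘ Real.tanh from rfl, image_comp,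
      Real.tanh_bijOn.image_eq, image_mul_left_Ioo hℓ]
    simp
  rw [← univ_prod_univ, prodMap_image_prod, h]

theorem hasFDerivAt_tanh_prod (ℓ : ℝ) (p : ℝ × ℝ) :
    HasFDerivAt (Prod.map (fun u => ℓ * Real.tanh u) (fun u => ℓ * Real.tanh u))
      ((ContinuousLinearMap.toSpanSingleton ℝ (ℓ * (1 / Real.cosh p.1 ^ 2))).prodMap
        (ContinuousLinearMap.toSpanSingleton ℝ (ℓ * (1 / Real.cosh p.2 ^ 2)))) p :=
  HasFDerivAt.prodMap p ((hasDerivAt_tanh p.1).const_mul ℓ).hasFDerivAt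
    ((hasDerivAt_tanh p.2).const_mul ℓ).hasFDerivAt

theorem det_toSpanSingleton_prod (a b : ℝ) :
    ((ContinuousLinearMap.toSpanSingleton ℝ a).prodMap
      (ContinuousLinearMap.toSpanSingleton ℝ b)).det = a * b := by
  have h1 := ContinuousLinearMap.det_toSpanSingleton a
  have h2 := ContinuousLinearMap.det_toSpanSingleton b
  rw [ContinuousLinearMap.det] at h1 h2 ⊢
  rw [ContinuousLinearMap.coe_prodMap, LinearMap.det_prodMap, h1, h2]

theorem injective_tanh_prod {ℓ : ℝ} (hℓ : 0 < ℓ) :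
    Function.Injective (Prod.map (fun u => ℓ * Real.tanh u) (fun u => ℓ * Real.tanh u)) := by
  have h : Function.Injective (fun u => ℓ * Real.tanh u) := fun x y hxy =>
    Real.tanh_injective (mul_left_cancel₀ hℓ.ne' hxy)
  exact h.prodMap h

theorem square_ae_eq (ℓ : ℝ) :
    square ℓ =ᵐ[volume] Ioo (-ℓ) ℓ ×ˢ Ioo (-ℓ) ℓ := by
  have h := (Ioo_ae_eq_Icc (μ := (volume : Measure ℝ)) (a := -ℓ) (b := ℓ)).symm
  exact Measure.set_prod_ae_eq h h

/-- The integrand of `K(s, t)` times the Jacobian of `(u, v) ↦ (ℓ tanh u, ℓ tanh v)`. -/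
theorem scalarIntegrand_tanh (m : ℝ) {ℓ : ℝ} (hℓ : 0 < ℓ) (s t : ℝ) (p : ℝ × ℝ) :
    |((ContinuousLinearMap.toSpanSingleton ℝ (ℓ * (1 / Real.cosh p.1 ^ 2))).prodMap
        (ContinuousLinearMap.toSpanSingleton ℝ (ℓ * (1 / Real.cosh p.2 ^ 2)))).det| •
      scalarIntegrand m ℓ s t (Prod.map (fun u => ℓ * Real.tanh u) (fun u => ℓ * Real.tanh u) p)
    = (ℓ / Real.pi : ℂ) * ((rapidityKernel m ℓ p : ℂ)
        * (cexp (2 * I * s * p.1) * cexp (-(2 * I * t * p.2)))) := by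
  have h1 := Real.cosh_pos p.1
  have h2 := Real.cosh_pos p.2
  have hpi := Real.pi_pos
  have hsq : (Real.sqrt (ℓ / Real.pi) : ℂ) * (Real.sqrt (ℓ / Real.pi) : ℂ) = ℓ / Real.pi := by
    rw [← ofReal_mul, Real.mul_self_sqrt (by positivity), ofReal_div]
  rw [det_toSpanSingleton_prod, abs_of_nonneg (by positivity), scalarIntegrand, Prod.map_fst,
    Prod.map_snd, Psi_tanh hℓ, Psi_tanh hℓ, map_mul, conj_ofReal, ← exp_conj, rapidityKernel,
    real_smul, ← hsq]
  have h3 : (starRingEnd ℂ) (-(2 * I * s * p.1)) = 2 * I * s * p.1 := by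
    rw [map_neg, map_mul, map_mul, map_mul, conj_I, conj_ofReal, conj_ofReal, map_ofNat]
    ring
  rw [h3]
  have h4 : (Real.cosh p.1 : ℂ) ≠ 0 := ofReal_ne_zero.2 h1.ne'
  have h5 : (Real.cosh p.2 : ℂ) ≠ 0 := ofReal_ne_zero.2 h2.ne'
  have h6 : (ℓ : ℂ) ≠ 0 := ofReal_ne_zero.2 hℓ.ne'
  simp only [ofReal_mul, ofReal_div, ofReal_one, ofReal_pow, ofReal_inv]
  field_simp

theorem integrableOn_square_iff (m : ℝ) {ℓ : ℝ} (hℓ : 0 < ℓ) (s t : ℝ) :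
    IntegrableOn (scalarIntegrand m ℓ s t) (square ℓ) ↔
      Integrable fun p : ℝ × ℝ => (ℓ / Real.pi : ℂ) * ((rapidityKernel m ℓ p : ℂ)
        * (cexp (2 * I * s * p.1) * cexp (-(2 * I * t * p.2)))) := by
  rw [integrableOn_congr_set_ae (square_ae_eq ℓ), ← image_tanh_prod hℓ,
    integrableOn_image_iff_integrableOn_abs_det_fderiv_smul volume MeasurableSet.univ
      (fun p _ => (hasFDerivAt_tanh_prod ℓ p).hasFDerivWithinAt) (injective_tanh_prod hℓ).injOn]
  simp only [scalarIntegrand_tanh m hℓ, integrableOn_univ]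

/-- In rapidity coordinates `K(s, t)` is a two-dimensional Fourier transform of
`rapidityKernel`. -/
theorem scalarKernel_eq_integral (m : ℝ) {ℓ : ℝ} (hℓ : 0 < ℓ) (s t : ℝ) :
    scalarKernel m ℓ s t = I / (2 * Real.pi ^ 2) * ∫ p : ℝ × ℝ, (rapidityKernel m ℓ p : ℂ)
        * (cexp (2 * I * s * p.1) * cexp (-(2 * I * t * p.2))) := by
  have h6 : (ℓ : ℂ) ≠ 0 := ofReal_ne_zero.2 hℓ.ne'
  have h7 : (Real.pi : ℂ) ≠ 0 := ofReal_ne_zero.2 Real.pi_ne_zero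
  rw [scalarKernel, setIntegral_congr_set (square_ae_eq ℓ), ← image_tanh_prod hℓ,
    integral_image_eq_integral_abs_det_fderiv_smul volume MeasurableSet.univ
      (fun p _ => (hasFDerivAt_tanh_prod ℓ p).hasFDerivWithinAt) (injective_tanh_prod hℓ).injOn]
  simp only [scalarIntegrand_tanh m hℓ, Measure.restrict_univ]
  rw [integral_const_mul]
  field_simp

/-! ### Integrability of the kernel in rapidity coordinates -/

theorem integrable_of_even {f : ℝ → ℝ} (hf : ∀ x, f (-x) = f x) (h : IntegrableOn f (Ioi 0)) :
    Integrable f := by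
  rw [← integrableOn_univ, ← Iic_union_Ioi (a := (0 : ℝ))]
  refine IntegrableOn.union ?_ h
  have h2 : IntegrableOn f (Ici 0) := Iff.mpr integrableOn_Ici_iff_integrableOn_Ioi h
  rw [← neg_zero] at h2
  simpa only [hf] using h2.comp_neg_Iic

theorem integrable_exp_neg_abs {c : ℝ} (hc : 0 < c) :
    Integrable fun u : ℝ => Real.exp (-(c * |u|)) := by
  refine integrable_of_even (fun x => by rw [abs_neg]) ?_
  refine (exp_neg_integrableOn_Ioi 0 hc).congr_fun (fun x hx => ?_) measurableSet_Ioi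
  simp only
  rw [abs_of_pos hx, neg_mul]

theorem abs_sinh_le_exp (w : ℝ) : |Real.sinh w| ≤ Real.exp |w| := by
  rw [Real.abs_sinh, Real.sinh_eq]
  have h1 := Real.exp_pos |w|
  have h2 := Real.exp_pos (-|w|)
  linarith

/-- Near the origin `|log sinh w|` is dominated by a small negative power of `sinh w`, at infinity
by a small positive one; the exponential absorbs the latter. -/
theorem integrable_log_sinh_exp {c : ℝ} (hc : 0 < c) :
    Integrable fun w : ℝ => |Real.log (Real.sinh w)| * Real.exp (-(c * |w|)) := by
  refine integrable_of_even (fun x => by rw [abs_neg, Real.sinh_neg, Real.log_neg_eq_log]) ?_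
  -- `ε ≤ c / 2` controls infinity, `ε < 1` controls the origin.
  set ε := min (c / 2) (1 / 2) with hε
  have hε0 : 0 < ε := lt_min (by linarith) (by norm_num)
  have hε1 : ε ≤ c / 2 := min_le_left _ _
  have hε2 : ε ≤ 1 / 2 := min_le_right _ _
  have h1 : IntegrableOn (fun w : ℝ => Real.exp (-(c / 2 * |w|))) (Ioi 0) :=
    (integrable_exp_neg_abs (show 0 < c / 2 by linarith)).integrableOn
  have h2 := integrableOn_sinh_rpow hε0 (by linarith)
  refine ((h1.add h2).div_const ε).mono' (Measurable.aestronglyMeasurable (by fun_prop))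
    ((ae_restrict_iff' measurableSet_Ioi).2 (ae_of_all _ fun w hw => ?_))
  have hs : 0 < Real.sinh w := Real.sinh_pos_iff.2 hw
  have hw' : 0 < w := hw
  rw [Real.norm_eq_abs, abs_mul, abs_abs, Real.abs_exp, Pi.add_apply]
  have h3 := abs_log_le_rpow_add_rpow hs hε0
  have h4 : Real.sinh w ^ ε ≤ Real.exp (c / 2 * |w|) := by
    have := abs_sinh_le_exp w
    rw [abs_of_pos hs] at this
    calc Real.sinh w ^ ε ≤ Real.exp |w| ^ ε := by gcongr
      _ = Real.exp (|w| * ε) := (Real.exp_mul _ _).symm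
      _ ≤ _ := by
        rw [mul_comm]
        gcongr
  have h5 : Real.exp (-(c * |w|)) ≤ 1 := Real.exp_le_one_iff.2 (by have := abs_nonneg w; nlinarith)
  have h6 : Real.exp (c / 2 * |w|) * Real.exp (-(c * |w|)) = Real.exp (-(c / 2 * |w|)) := by
    rw [← Real.exp_add]; ring_nf
  have h7 := Real.exp_pos (-(c * |w|))
  have h8 := Real.rpow_pos_of_pos hs (-ε)
  calc _ ≤ (Real.sinh w ^ ε + Real.sinh w ^ (-ε)) / ε * Real.exp (-(c * |w|)) := by gcongr
    _ = (Real.sinh w ^ ε * Real.exp (-(c * |w|))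
        + Real.sinh w ^ (-ε) * Real.exp (-(c * |w|))) / ε := by ring
    _ ≤ (Real.exp (c / 2 * |w|) * Real.exp (-(c * |w|)) + Real.sinh w ^ (-ε) * 1) / ε := by
      gcongr
    _ = _ := by rw [h6, mul_one]

theorem inv_cosh_le (u : ℝ) : (Real.cosh u)⁻¹ ≤ 2 * Real.exp (-|u|) := by
  rw [inv_le_iff_one_le_mul₀ (Real.cosh_pos u), ← Real.cosh_abs, Real.cosh_eq]
  have : Real.exp |u| * Real.exp (-|u|) = 1 := by rw [← Real.exp_add]; simp
  nlinarith [Real.exp_pos (-|u|)]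

theorem log_cosh_le (u : ℝ) : Real.log (Real.cosh u) ≤ |u| := by
  rw [Real.log_le_iff_le_exp (Real.cosh_pos u), ← Real.cosh_abs, Real.cosh_eq]
  have : Real.exp (-|u|) ≤ Real.exp |u| := Real.exp_le_exp.2 (by linarith [abs_nonneg u])
  linarith

/-- The constant `ln (m ℓ e^γ / 2)`. -/
noncomputable def rapidityConst (m ℓ : ℝ) : ℝ :=
  Real.log (m * ℓ / 2 * Real.exp Real.eulerMascheroniConstant)

theorem logTerm_tanh {m ℓ : ℝ} (hm : 0 < m) (hℓ : 0 < ℓ) {u v : ℝ} (huv : u ≠ v) :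
    logTerm m (ℓ * Real.tanh u) (ℓ * Real.tanh v)
      = rapidityConst m ℓ + Real.log (Real.sinh (u - v)) - Real.log (Real.cosh u)
        - Real.log (Real.cosh v) := by
  have h1 := Real.cosh_pos u
  have h2 := Real.cosh_pos v
  have h3 : 0 < |Real.sinh (u - v)| := abs_pos.2 (Real.sinh_ne_zero.2 (sub_ne_zero.2 huv))
  have h4 := Real.exp_pos Real.eulerMascheroniConstant
  rw [logTerm, rapidityConst, ← mul_sub, tanh_sub_tanh, abs_mul, abs_div, abs_of_pos hℓ,
    abs_of_pos (mul_pos h1 h2), ← Real.log_abs (Real.sinh _), sub_sub,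
    ← Real.log_mul h1.ne' h2.ne', ← Real.log_mul (by positivity) h3.ne',
    ← Real.log_div (by positivity) (by positivity)]
  congr 1
  ring

theorem logTerm_self (m x : ℝ) : logTerm m x x = 0 := by simp [logTerm]

theorem abs_logTerm_tanh_le {m ℓ : ℝ} (hm : 0 < m) (hℓ : 0 < ℓ) (u v : ℝ) :
    |logTerm m (ℓ * Real.tanh u) (ℓ * Real.tanh v)|
      ≤ |rapidityConst m ℓ| + |Real.log (Real.sinh (u - v))| + (|u| + |v|) := by
  -- On the diagonal `logTerm` takes the junk value `log 0 = 0`.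
  rcases eq_or_ne u v with rfl | h
  · rw [logTerm_self, abs_zero]; positivity
  · rw [logTerm_tanh hm hℓ h]
    have h1 := log_cosh_le u
    have h2 := log_cosh_le v
    have h3 := Real.log_nonneg (Real.one_le_cosh u)
    have h4 := Real.log_nonneg (Real.one_le_cosh v)
    have h5 := abs_le.1 (le_refl |rapidityConst m ℓ|)
    have h6 := abs_le.1 (le_refl |Real.log (Real.sinh (u - v))|)
    rw [abs_le]
    constructor <;> linarith [abs_nonneg u, abs_nonneg v]

theorem integrable_log_sinh_sub {c : ℝ} (hc : 0 < c) :
    Integrable fun p : ℝ × ℝ =>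
      |Real.log (Real.sinh (p.1 - p.2))| * Real.exp (-(c * (|p.1| + |p.2|))) := by
  have h1 := (integrable_log_sinh_exp (half_pos hc)).mul_prod (integrable_exp_neg_abs (half_pos hc))
  have h2 := (measurePreserving_sub_prod (volume : Measure ℝ)
    (volume : Measure ℝ)).integrable_comp_of_integrable h1
  refine h2.mono' (Measurable.aestronglyMeasurable (by fun_prop)) (ae_of_all _ fun p => ?_)
  rw [Real.norm_eq_abs, abs_mul, abs_abs, Real.abs_exp, Function.comp_apply, mul_assoc,
    ← Real.exp_add]
  gcongr
  have := abs_sub p.1 p.2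
  have := abs_nonneg p.1
  nlinarith

theorem measurable_rapidityKernel (m ℓ : ℝ) : Measurable (rapidityKernel m ℓ) := by
  have : Measurable Real.tanh :=
    (continuous_iff_continuousAt.2 fun u => (hasDerivAt_tanh u).continuousAt).measurable
  unfold rapidityKernel logTerm
  fun_prop

/-- Exponential integrability of the kernel. It gives absolute convergence, and all polynomial
moments needed for smoothness of the Fourier transform. -/
theorem integrable_exp_mul_rapidityKernel {m ℓ : ℝ} (hm : 0 < m) (hℓ : 0 < ℓ) :
    Integrable fun p : ℝ × ℝ => Real.exp ((|p.1| + |p.2|) / 4) * |rapidityKernel m ℓ p| := by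
  have h1 := integrable_exp_neg_abs (show (0 : ℝ) < 1 / 2 by norm_num)
  have h2 := ((h1.mul_prod h1).const_mul (4 * (|rapidityConst m ℓ| + 4))).add
    ((integrable_log_sinh_sub (show (0 : ℝ) < 1 / 2 by norm_num)).const_mul 4)
  have := measurable_rapidityKernel m ℓ
  refine h2.mono' (Measurable.aestronglyMeasurable (by fun_prop)) (ae_of_all _ fun p => ?_)
  have ha := abs_nonneg p.1
  have hb := abs_nonneg p.2
  have hu := inv_cosh_le p.1
  have hv := inv_cosh_le p.2
  have hu' := inv_pos.2 (Real.cosh_pos p.1)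
  have hv' := inv_pos.2 (Real.cosh_pos p.2)
  have hk := abs_logTerm_tanh_le hm hℓ p.1 p.2
  have hσ : |p.1| + |p.2| ≤ 4 * Real.exp ((|p.1| + |p.2|) / 4) := by
    linarith [Real.add_one_le_exp ((|p.1| + |p.2|) / 4)]
  have hone : 1 ≤ Real.exp ((|p.1| + |p.2|) / 4) := Real.one_le_exp (by positivity)
  rw [Real.norm_eq_abs, abs_mul, Real.abs_exp, abs_abs, rapidityKernel, abs_mul,
    abs_of_pos (mul_pos hu' hv')]
  simp only [Pi.add_apply]
  set E := Real.exp ((|p.1| + |p.2|) / 4) with hE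
  set Λ := |Real.log (Real.sinh (p.1 - p.2))|
  have hΛ : 0 ≤ Λ := abs_nonneg _
  have e1 : Real.exp (-|p.1|) * Real.exp (-|p.2|) * (E * E)
      = Real.exp (-(1 / 2 * (|p.1| + |p.2|))) := by
    rw [hE, ← Real.exp_add, ← Real.exp_add, ← Real.exp_add]; ring_nf
  have e2 : Real.exp (-(1 / 2 * |p.1|)) * Real.exp (-(1 / 2 * |p.2|))
      = Real.exp (-(1 / 2 * (|p.1| + |p.2|))) := by
    rw [← Real.exp_add]; ring_nf
  rw [e2, ← e1]
  calc _ ≤ E * ((|rapidityConst m ℓ| + Λ + (|p.1| + |p.2|))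
          * ((2 * Real.exp (-|p.1|)) * (2 * Real.exp (-|p.2|)))) := by gcongr
    _ ≤ E * ((|rapidityConst m ℓ| * E + Λ * E + 4 * E)
          * ((2 * Real.exp (-|p.1|)) * (2 * Real.exp (-|p.2|)))) := by
        gcongr
        · exact le_mul_of_one_le_right (abs_nonneg _) hone
        · exact le_mul_of_one_le_right hΛ hone
    _ = _ := by ring

theorem integrable_rapidityKernel {m ℓ : ℝ} (hm : 0 < m) (hℓ : 0 < ℓ) :
    Integrable (rapidityKernel m ℓ) := by
  refine (integrable_exp_mul_rapidityKernel hm hℓ).mono'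
    (measurable_rapidityKernel m ℓ).aestronglyMeasurable (ae_of_all _ fun p => ?_)
  exact le_mul_of_one_le_left (abs_nonneg _) (Real.one_le_exp (by positivity))

theorem norm_exp_two_I_neg (s u : ℝ) : ‖cexp (-(2 * I * s * u))‖ = 1 := by
  have := norm_exp_two_I (-s) u
  rwa [ofReal_neg, mul_neg, neg_mul] at this

theorem integrable_ofReal_mul_exp {f : ℝ × ℝ → ℝ} (hf : Integrable f) (s t : ℝ) :
    Integrable fun p : ℝ × ℝ =>
      (f p : ℂ) * (cexp (2 * I * s * p.1) * cexp (-(2 * I * t * p.2))) := by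
  refine hf.norm.mono' (hf.ofReal.aestronglyMeasurable.mul
    (Measurable.aestronglyMeasurable (by fun_prop))) (ae_of_all _ fun p => ?_)
  rw [norm_mul, norm_mul, norm_exp_two_I, norm_exp_two_I_neg, mul_one, mul_one, norm_real]

theorem integrable_pow_mul_rapidityKernel {m ℓ : ℝ} (hm : 0 < m) (hℓ : 0 < ℓ) (n : ℕ) :
    Integrable fun p : ℝ × ℝ => ‖p‖ ^ n * |rapidityKernel m ℓ p| := by
  have := measurable_rapidityKernel m ℓ
  refine ((integrable_exp_mul_rapidityKernel hm hℓ).const_mul (n.factorial * 4 ^ n : ℝ)).mono'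
    (Measurable.aestronglyMeasurable (by fun_prop)) (ae_of_all _ fun p => ?_)
  rw [Real.norm_eq_abs, abs_mul, abs_abs, abs_pow, abs_norm, ← mul_assoc]
  gcongr
  have h1 : ‖p‖ ≤ |p.1| + |p.2| := by
    rw [Prod.norm_def, Real.norm_eq_abs, Real.norm_eq_abs]
    exact max_le (by linarith [abs_nonneg p.2]) (by linarith [abs_nonneg p.1])
  have h2 := Real.pow_div_factorial_le_exp _ (show 0 ≤ (|p.1| + |p.2|) / 4 by positivity) n
  rw [div_le_iff₀ (by positivity), div_pow, div_le_iff₀ (by positivity)] at h2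
  calc _ ≤ (|p.1| + |p.2|) ^ n := by gcongr
    _ ≤ _ := h2
    _ = _ := by ring

theorem integrableOn_scalarIntegrand {m ℓ : ℝ} (hm : 0 < m) (hℓ : 0 < ℓ) (s t : ℝ) :
    IntegrableOn (scalarIntegrand m ℓ s t) (square ℓ) :=
  (integrableOn_square_iff m hℓ s t).2
    ((integrable_ofReal_mul_exp (integrable_rapidityKernel hm hℓ) s t).const_mul _)

/-! ### Fourier transform of a product of two shifted `1 / cosh` -/

theorem integrable_mul_exp {f : ℝ → ℝ} (hf : Integrable f) (s : ℝ) :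
    Integrable fun u : ℝ => (f u : ℂ) * cexp (2 * I * s * u) := by
  refine hf.norm.mono' (hf.ofReal.aestronglyMeasurable.mul
    (Measurable.aestronglyMeasurable (by fun_prop))) (ae_of_all _ fun u => ?_)
  rw [norm_mul, norm_exp_two_I, mul_one, norm_real]

theorem integrable_inv_cosh : Integrable fun u : ℝ => (Real.cosh u)⁻¹ := by
  simpa only [Real.rpow_neg_one] using integrable_cosh_rpow one_pos

theorem integrable_inv_cosh_sq : Integrable fun u : ℝ => (Real.cosh u ^ 2)⁻¹ := by
  refine (integrable_cosh_rpow two_pos).congr (ae_of_all _ fun u => ?_)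
  simp only
  rw [Real.rpow_neg (Real.cosh_pos u).le, Real.rpow_two]

theorem inv_cosh_le_one (u : ℝ) : (Real.cosh u)⁻¹ ≤ 1 := inv_le_one_of_one_le₀ (Real.one_le_cosh u)

/-- The identity `1 / (cosh (w + v) cosh v) = (tanh (w + v) - tanh v) / sinh w` and an integration
by parts in `v` reduce this to the Fourier transform of `1 / cosh ^ 2`. -/
theorem integral_inv_cosh_mul_inv_cosh {r : ℝ} (hr : r ≠ 0) {w : ℝ} (hw : w ≠ 0) :
    ∫ v : ℝ, (((Real.cosh (w + v))⁻¹ * (Real.cosh v)⁻¹ : ℝ) : ℂ) * cexp (2 * I * r * v)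
      = Real.pi / (I * Real.sinh (Real.pi * r) * Real.sinh w)
        * (1 - cexp (-(2 * I * r * w))) := by
  have hr' : (r : ℂ) ≠ 0 := ofReal_ne_zero.2 hr
  have hs : (Real.sinh w : ℂ) ≠ 0 := ofReal_ne_zero.2 (Real.sinh_ne_zero.2 hw)
  have hsr : (Real.sinh (Real.pi * r) : ℂ) ≠ 0 :=
    ofReal_ne_zero.2 (Real.sinh_ne_zero.2 (mul_ne_zero Real.pi_ne_zero hr))
  have hc : (2 * I * r : ℂ) ≠ 0 := mul_ne_zero (mul_ne_zero two_ne_zero I_ne_zero) hr'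
  have htanh : ∀ v, Real.tanh (w + v) - Real.tanh v
      = Real.sinh w * ((Real.cosh (w + v))⁻¹ * (Real.cosh v)⁻¹) := by
    intro v
    rw [tanh_sub_tanh, add_sub_cancel_right, div_eq_mul_inv, mul_inv]
  have hi1 : Integrable fun v : ℝ => (Real.cosh (w + v))⁻¹ * (Real.cosh v)⁻¹ := by
    refine integrable_inv_cosh.mono' (Measurable.aestronglyMeasurable (by fun_prop))
      (ae_of_all _ fun v => ?_)
    have h1 := inv_pos.2 (Real.cosh_pos (w + v))
    have h2 := inv_pos.2 (Real.cosh_pos v)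
    rw [Real.norm_eq_abs, abs_of_pos (mul_pos h1 h2)]
    exact mul_le_of_le_one_left h2.le (inv_cosh_le_one _)
  have hi2 : Integrable fun v : ℝ => (Real.cosh (w + v) ^ 2)⁻¹ :=
    integrable_inv_cosh_sq.comp_add_left w
  have hE : ∀ v : ℝ, HasDerivAt (fun v : ℝ => cexp (2 * I * r * v) / (2 * I * r))
      (cexp (2 * I * r * v)) v := by
    intro v
    have := ((((hasDerivAt_id v).ofReal_comp).const_mul (2 * I * (r : ℂ))).cexp).div_const
      (2 * I * (r : ℂ))
    refine this.congr_deriv ?_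
    simp only [id, ofReal_one, mul_one]
    rw [mul_div_cancel_right₀ _ hc]
  have hT : ∀ v : ℝ, HasDerivAt (fun v : ℝ => ((Real.tanh (w + v) - Real.tanh v : ℝ) : ℂ))
      (((Real.cosh (w + v) ^ 2)⁻¹ - (Real.cosh v ^ 2)⁻¹ : ℝ) : ℂ) v := by
    intro v
    have h1 := (((hasDerivAt_tanh (w + v)).comp_const_add w v).sub (hasDerivAt_tanh v)).ofReal_comp
    simp only [one_div] at h1
    exact h1
  have hu : Integrable fun v : ℝ => Real.tanh (w + v) - Real.tanh v := by
    simp only [htanh]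
    exact hi1.const_mul _
  have ibp := integral_mul_deriv_eq_deriv_mul_of_integrable (fun v _ => hT v) (fun v _ => hE v)
    (integrable_mul_exp hu r)
    (((integrable_mul_exp (hi2.sub integrable_inv_cosh_sq) r).div_const (2 * I * r)).congr
      (ae_of_all _ fun v => mul_div_assoc _ _ _))
    (((integrable_mul_exp hu r).div_const (2 * I * r)).congr
      (ae_of_all _ fun v => mul_div_assoc _ _ _))
  have hshift : ∫ v : ℝ, (((Real.cosh (w + v) ^ 2)⁻¹ : ℝ) : ℂ) * cexp (2 * I * r * v)
      = cexp (-(2 * I * r * w)) * (2 * Real.pi * r / Real.sinh (Real.pi * r)) := by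
    rw [← integral_inv_cosh_sq hr, ← integral_const_mul, ← integral_add_left_eq_self
      (fun v : ℝ => cexp (-(2 * I * r * w))
        * ((((Real.cosh v ^ 2)⁻¹ : ℝ) : ℂ) * cexp (2 * I * r * v))) w]
    refine integral_congr_ae (ae_of_all _ fun v => ?_)
    simp only
    rw [mul_left_comm, ← Complex.exp_add]
    congr 2
    push_cast
    ring
  have h0 := integral_sub (integrable_mul_exp hi2 r) (integrable_mul_exp integrable_inv_cosh_sq r)
  rw [hshift, integral_inv_cosh_sq hr] at h0
  simp only [htanh, ofReal_sub, sub_mul, ← mul_div_assoc, integral_div] at ibp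
  rw [h0] at ibp
  have h1 : ∀ v : ℝ, ((Real.sinh w * ((Real.cosh (w + v))⁻¹ * (Real.cosh v)⁻¹) : ℝ) : ℂ)
      * cexp (2 * I * r * v) = Real.sinh w
        * ((((Real.cosh (w + v))⁻¹ * (Real.cosh v)⁻¹ : ℝ) : ℂ) * cexp (2 * I * r * v)) := by
    intro v
    push_cast
    ring
  simp only [h1, integral_const_mul] at ibp
  refine mul_left_cancel₀ hs (ibp.trans ?_)
  generalize (Real.sinh w : ℂ) = S at hs ⊢
  generalize (Real.sinh (Real.pi * r) : ℂ) = S at hsr ⊢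
  field_simp
  ring

theorem integral_eq_integral_Ioi {f : ℝ → ℂ} (hf : Integrable f) :
    ∫ x, f x = ∫ x in Ioi 0, (f x + f (-x)) := by
  have h2 : IntegrableOn (fun x => f (-x)) (Ioi 0) := hf.comp_neg.integrableOn
  rw [integral_add hf.integrableOn h2, integral_comp_neg_Ioi, neg_zero, add_comm,
    ← setIntegral_union (Iic_disjoint_Ioi le_rfl) measurableSet_Ioi hf.integrableOn
    hf.integrableOn, Iic_union_Ioi, Measure.restrict_univ]

/-! ### The explicit form off the diagonal -/

theorem integrable_log_sinh_kernel : Integrable fun p : ℝ × ℝ =>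
    Real.log (Real.sinh (p.1 - p.2)) * ((Real.cosh p.1)⁻¹ * (Real.cosh p.2)⁻¹) := by
  refine ((integrable_log_sinh_sub one_pos).const_mul 4).mono'
    (Measurable.aestronglyMeasurable (by fun_prop)) (ae_of_all _ fun p => ?_)
  have hu := inv_cosh_le p.1
  have hv := inv_cosh_le p.2
  have hu' := inv_pos.2 (Real.cosh_pos p.1)
  have hv' := inv_pos.2 (Real.cosh_pos p.2)
  rw [Real.norm_eq_abs, abs_mul, abs_of_pos (mul_pos hu' hv')]
  calc _ ≤ |Real.log (Real.sinh (p.1 - p.2))|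
        * ((2 * Real.exp (-|p.1|)) * (2 * Real.exp (-|p.2|))) := by gcongr
    _ = 4 * (|Real.log (Real.sinh (p.1 - p.2))| * (Real.exp (-|p.1|) * Real.exp (-|p.2|))) := by
      ring
    _ = _ := by rw [← Real.exp_add]; ring_nf

/-- The shear `w = u - v` and Fubini's theorem: the integral over `v` at fixed `w` is elementary
(`integral_inv_cosh_mul_inv_cosh`). Since `1 / sinh` is odd, adding the values at `w` and `-w`
turns the exponentials that are left into sines, to which `integral_log_sinh_mul_sin` applies. -/
theorem integral_log_sinh_kernel {s t : ℝ} (hst : s ≠ t) :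
    ∫ p : ℝ × ℝ, ((Real.log (Real.sinh (p.1 - p.2))
        * ((Real.cosh p.1)⁻¹ * (Real.cosh p.2)⁻¹) : ℝ) : ℂ)
        * (cexp (2 * I * s * p.1) * cexp (-(2 * I * t * p.2)))
      = -(Real.pi ^ 2 / Real.sinh (Real.pi * (s - t))
        * (Real.tanh (Real.pi * s) * shiftedDigamma s
          - Real.tanh (Real.pi * t) * shiftedDigamma t)) := by
  have hr : s - t ≠ 0 := sub_ne_zero.2 hst
  -- `g (w, v)` is the integrand at `u = w + v`.
  set g : ℝ × ℝ → ℂ := fun q => ((Real.log (Real.sinh q.1)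
        * ((Real.cosh (q.1 + q.2))⁻¹ * (Real.cosh q.2)⁻¹) : ℝ) : ℂ)
        * (cexp (2 * I * s * q.1) * cexp (2 * I * (s - t : ℝ) * q.2)) with hg
  have hmp := measurePreserving_sub_prod (volume : Measure ℝ) (volume : Measure ℝ)
  have hgm : Measurable g := by rw [hg]; fun_prop
  have hcomp : ∀ p : ℝ × ℝ, g (p.1 - p.2, p.2) = ((Real.log (Real.sinh (p.1 - p.2))
        * ((Real.cosh p.1)⁻¹ * (Real.cosh p.2)⁻¹) : ℝ) : ℂ)
        * (cexp (2 * I * s * p.1) * cexp (-(2 * I * t * p.2))) := by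
    intro p
    simp only [hg, sub_add_cancel]
    rw [← Complex.exp_add, ← Complex.exp_add]
    congr 2
    push_cast
    ring
  have hint : Integrable g := by
    have h1 := integrable_ofReal_mul_exp integrable_log_sinh_kernel s t
    refine (hmp.integrable_comp hgm.aestronglyMeasurable).1 (h1.congr (ae_of_all _ fun p => ?_))
    exact (hcomp p).symm
  have hmap : ∫ p : ℝ × ℝ, g (p.1 - p.2, p.2) = ∫ q, g q := by
    have h1 := integral_map (μ := (volume : Measure (ℝ × ℝ))) hmp.measurable.aemeasurable
      (f := g) hgm.aestronglyMeasurable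
    have h2 := hmp.map_eq
    rw [← Measure.volume_eq_prod] at h2
    rw [← h1, h2]
  simp only [hcomp] at hmap
  rw [hmap, Measure.volume_eq_prod, integral_prod _ hint]
  have hinner : ∀ w : ℝ, w ≠ 0 → ∫ v : ℝ, g (w, v)
      = Real.pi / (I * Real.sinh (Real.pi * (s - t))) * ((Real.log (Real.sinh w)
        * (Real.sinh w)⁻¹ : ℝ) * (cexp (2 * I * s * w) - cexp (2 * I * t * w))) := by
    intro w hw
    have h1 : ∀ v : ℝ, g (w, v) = (Real.log (Real.sinh w) * cexp (2 * I * s * w))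
        * ((((Real.cosh (w + v))⁻¹ * (Real.cosh v)⁻¹ : ℝ) : ℂ)
          * cexp (2 * I * (s - t : ℝ) * v)) := by
      intro v
      simp only [hg]
      push_cast
      ring
    have h2 : cexp (2 * I * t * w)
        = cexp (2 * I * s * w) * cexp (-(2 * I * (s - t : ℝ) * w)) := by
      rw [← Complex.exp_add]
      congr 1
      push_cast
      ring
    simp only [h1]
    rw [integral_const_mul, integral_inv_cosh_mul_inv_cosh hr hw, h2, ofReal_mul, ofReal_inv,
      div_eq_mul_inv, div_eq_mul_inv, mul_inv (I * _)]
    ring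
  have hae : (fun w : ℝ => ∫ v : ℝ, g (w, v)) =ᵐ[volume] fun w : ℝ =>
      Real.pi / (I * Real.sinh (Real.pi * (s - t))) * ((Real.log (Real.sinh w)
        * (Real.sinh w)⁻¹ : ℝ) * (cexp (2 * I * s * w) - cexp (2 * I * t * w))) := by
    filter_upwards [compl_mem_ae_iff.2 (measure_singleton (0 : ℝ))] with w hw
    exact hinner w hw
  rw [integral_congr_ae hae,
    integral_eq_integral_Ioi ((Integrable.integral_prod_left hint).congr hae)]
  have hfold : ∀ w : ℝ, Real.pi / (I * Real.sinh (Real.pi * (s - t))) * ((Real.log (Real.sinh w)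
        * (Real.sinh w)⁻¹ : ℝ) * (cexp (2 * I * s * w) - cexp (2 * I * t * w)))
      + Real.pi / (I * Real.sinh (Real.pi * (s - t))) * ((Real.log (Real.sinh (-w))
        * (Real.sinh (-w))⁻¹ : ℝ) * (cexp (2 * I * s * (-w : ℝ)) - cexp (2 * I * t * (-w : ℝ))))
      = 2 * Real.pi / Real.sinh (Real.pi * (s - t)) *
        (((Real.log (Real.sinh w) * (Real.sinh w)⁻¹ * Real.sin (2 * s * w) : ℝ) : ℂ)
          - ((Real.log (Real.sinh w) * (Real.sinh w)⁻¹ * Real.sin (2 * t * w) : ℝ) : ℂ)) := by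
    intro w
    have e : ∀ s : ℝ, cexp (2 * I * s * w)
        = Real.cos (2 * s * w) + Real.sin (2 * s * w) * I := by
      intro s
      push_cast
      rw [← Complex.exp_mul_I]
      congr 1
      ring
    have e' : ∀ s : ℝ, cexp (2 * I * s * (-w : ℝ))
        = Real.cos (2 * s * w) - Real.sin (2 * s * w) * I := by
      intro s
      have := e (-s)
      rw [mul_neg, neg_mul, Real.cos_neg, Real.sin_neg, ofReal_neg, ofReal_neg, neg_mul] at this
      rw [ofReal_neg, sub_eq_add_neg, ← this]
      congr 1
      ring
    rw [e, e, e', e', Real.sinh_neg, Real.log_neg_eq_log, div_mul_eq_div_div_swap, div_I]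
    push_cast
    rw [inv_neg]
    linear_combination (-(2 * Real.pi / sinh (Real.pi * (s - t)) * (↑(Real.log (Real.sinh w))
      * (sinh w)⁻¹) * (sin (2 * s * w) - sin (2 * t * w)))) * I_sq
  simp only [hfold]
  have hsin : ∀ s : ℝ, IntegrableOn (fun w => Real.log (Real.sinh w) * (Real.sinh w)⁻¹
      * Real.sin (2 * s * w)) (Ioi 0) := fun s =>
    (hasDerivAt_integral_sinh_rpow (φ := fun w => Real.sin (2 * s * w))
      (A := 1 + |2 * s|) (by fun_prop)
      (fun w => (Real.abs_sin_le_one _).trans (by linarith [abs_nonneg (2 * s)]))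
      (fun w hw => (abs_sin_le_self_mul hw).trans (by gcongr; linarith))).1
  rw [integral_const_mul, integral_sub (hsin s).ofReal (hsin t).ofReal, integral_complex_ofReal,
    integral_complex_ofReal, integral_log_sinh_mul_sin, integral_log_sinh_mul_sin]
  ring

theorem diagonal_ae : ∀ᵐ p : ℝ × ℝ, p.1 ≠ p.2 := by
  have h := (quasiMeasurePreserving_sub (volume : Measure ℝ) (volume : Measure ℝ)).ae
    (compl_mem_ae_iff.2 (measure_singleton (0 : ℝ)))
  rw [Measure.volume_eq_prod]
  filter_upwards [h] with p hp
  exact fun h => hp (by simp [h])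

theorem integral_prod_kernel (f g : ℝ → ℝ) (s t : ℝ) :
    ∫ p : ℝ × ℝ, ((f p.1 * g p.2 : ℝ) : ℂ) * (cexp (2 * I * s * p.1) * cexp (-(2 * I * t * p.2)))
      = (∫ u : ℝ, (f u : ℂ) * cexp (2 * I * s * u))
        * ∫ v : ℝ, (g v : ℂ) * cexp (2 * I * (-t : ℝ) * v) := by
  rw [Measure.volume_eq_prod, ← integral_prod_mul]
  refine integral_congr_ae (ae_of_all _ fun p => ?_)
  simp only
  rw [ofReal_neg, mul_neg, neg_mul]
  push_cast
  ring

theorem digammaSum_neg (s : ℝ) : digammaSum (-s) = digammaSum s := by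
  rw [digammaSum, digammaSum, ofReal_neg, mul_neg, sub_neg_eq_add, ← sub_eq_add_neg, add_comm]

theorem integrable_log_cosh_inv : Integrable fun u : ℝ =>
    Real.log (Real.cosh u) * (Real.cosh u)⁻¹ := by
  refine integrable_log_cosh.mono' (Measurable.aestronglyMeasurable (by fun_prop))
    (ae_of_all _ fun u => ?_)
  have h1 := Real.one_le_cosh u
  have h2 := Real.log_nonneg h1
  have h3 := inv_pos.2 (Real.cosh_pos u)
  rw [Real.norm_eq_abs, abs_of_nonneg (mul_nonneg h2 h3.le), ← Real.rpow_neg_one]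
  gcongr
  norm_num

theorem integral_add_sub_sub {α : Type*} [MeasurableSpace α] {μ : Measure α} {f₁ f₂ f₃ f₄ : α → ℂ}
    (h₁ : Integrable f₁ μ) (h₂ : Integrable f₂ μ) (h₃ : Integrable f₃ μ) (h₄ : Integrable f₄ μ) :
    ∫ x, (f₁ x + f₂ x - f₃ x - f₄ x) ∂μ
      = (∫ x, f₁ x ∂μ) + (∫ x, f₂ x ∂μ) - (∫ x, f₃ x ∂μ) - ∫ x, f₄ x ∂μ := by
  have h₁₂ : Integrable (fun x => f₁ x + f₂ x) μ := h₁.add h₂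
  have h₁₂₃ : Integrable (fun x => f₁ x + f₂ x - f₃ x) μ := h₁₂.sub h₃
  rw [integral_sub h₁₂₃ h₄, integral_sub h₁₂ h₃, integral_add h₁ h₂]

theorem integral_rapidityKernel {m ℓ : ℝ} (hm : 0 < m) (hℓ : 0 < ℓ) {s t : ℝ} (hst : s ≠ t) :
    ∫ p : ℝ × ℝ, (rapidityKernel m ℓ p : ℂ)
        * (cexp (2 * I * s * p.1) * cexp (-(2 * I * t * p.2)))
      = Real.pi ^ 2 * ((rapidityConst m ℓ + shiftedDigamma s + shiftedDigamma t)
          / (Real.cosh (Real.pi * s) * Real.cosh (Real.pi * t))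
        - (Real.tanh (Real.pi * s) * shiftedDigamma s
          - Real.tanh (Real.pi * t) * shiftedDigamma t) / Real.sinh (Real.pi * (s - t))) := by
  have hsplit : (fun p : ℝ × ℝ => (rapidityKernel m ℓ p : ℂ)
        * (cexp (2 * I * s * p.1) * cexp (-(2 * I * t * p.2)))) =ᵐ[volume] fun p =>
      (((rapidityConst m ℓ * (Real.cosh p.1)⁻¹) * (Real.cosh p.2)⁻¹ : ℝ) : ℂ)
        * (cexp (2 * I * s * p.1) * cexp (-(2 * I * t * p.2)))
      + ((Real.log (Real.sinh (p.1 - p.2)) * ((Real.cosh p.1)⁻¹ * (Real.cosh p.2)⁻¹) : ℝ) : ℂ)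
        * (cexp (2 * I * s * p.1) * cexp (-(2 * I * t * p.2)))
      - (((Real.log (Real.cosh p.1) * (Real.cosh p.1)⁻¹) * (Real.cosh p.2)⁻¹ : ℝ) : ℂ)
        * (cexp (2 * I * s * p.1) * cexp (-(2 * I * t * p.2)))
      - (((Real.cosh p.1)⁻¹ * (Real.log (Real.cosh p.2) * (Real.cosh p.2)⁻¹) : ℝ) : ℂ)
        * (cexp (2 * I * s * p.1) * cexp (-(2 * I * t * p.2))) := by
    filter_upwards [diagonal_ae] with p hp
    rw [rapidityKernel, logTerm_tanh hm hℓ hp]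
    push_cast
    ring
  have i1 := integrable_ofReal_mul_exp
    ((integrable_inv_cosh.const_mul (rapidityConst m ℓ)).mul_prod integrable_inv_cosh) s t
  have i2 := integrable_ofReal_mul_exp integrable_log_sinh_kernel s t
  have i3 := integrable_ofReal_mul_exp (integrable_log_cosh_inv.mul_prod integrable_inv_cosh) s t
  have i4 := integrable_ofReal_mul_exp (integrable_inv_cosh.mul_prod integrable_log_cosh_inv) s t
  rw [integral_congr_ae hsplit, integral_add_sub_sub i1 i2 i3 i4, integral_log_sinh_kernel hst,
    integral_prod_kernel (fun u => rapidityConst m ℓ * (Real.cosh u)⁻¹) (fun v => (Real.cosh v)⁻¹),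
    integral_prod_kernel (fun u => Real.log (Real.cosh u) * (Real.cosh u)⁻¹)
      (fun v => (Real.cosh v)⁻¹),
    integral_prod_kernel (fun u => (Real.cosh u)⁻¹)
      (fun v => Real.log (Real.cosh v) * (Real.cosh v)⁻¹),
    integral_log_cosh, integral_log_cosh, integral_inv_cosh, integral_inv_cosh]
  have h1 : ∫ u : ℝ, ((rapidityConst m ℓ * (Real.cosh u)⁻¹ : ℝ) : ℂ) * cexp (2 * I * s * u)
      = rapidityConst m ℓ * (Real.pi / Real.cosh (Real.pi * s)) := by
    rw [← integral_inv_cosh, ← integral_const_mul]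
    refine integral_congr_ae (ae_of_all _ fun u => ?_)
    simp only
    rw [ofReal_mul, mul_assoc]
  have h2 : shiftedDigamma (-t) = shiftedDigamma t := by
    rw [shiftedDigamma, shiftedDigamma, digammaSum_neg]
  rw [h1, h2, mul_neg, Real.cosh_neg]
  ring

theorem scalarKernel_of_ne {m ℓ : ℝ} (hm : 0 < m) (hℓ : 0 < ℓ) {s t : ℝ} (hst : s ≠ t) :
    scalarKernel m ℓ s t =
      I * (logConst m ℓ : ℂ) / (2 * (Real.cosh (Real.pi * s) : ℂ) * (Real.cosh (Real.pi * t) : ℂ))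
        - I * (Real.tanh (Real.pi * t) : ℂ) / (4 * (Real.sinh (Real.pi * (s - t)) : ℂ))
          * digammaSum s
        + I * (Real.tanh (Real.pi * s) : ℂ) / (4 * (Real.sinh (Real.pi * (s - t)) : ℂ))
          * digammaSum t := by
  have hpi : (Real.pi : ℂ) ≠ 0 := ofReal_ne_zero.2 Real.pi_ne_zero
  have hs : (Real.cosh (Real.pi * s) : ℂ) ≠ 0 := ofReal_ne_zero.2 (Real.cosh_pos _).ne'
  have ht : (Real.cosh (Real.pi * t) : ℂ) ≠ 0 := ofReal_ne_zero.2 (Real.cosh_pos _).ne'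
  have hr : (Real.sinh (Real.pi * (s - t)) : ℂ) ≠ 0 := ofReal_ne_zero.2
    (Real.sinh_ne_zero.2 (mul_ne_zero Real.pi_ne_zero (sub_ne_zero.2 hst)))
  have hlog : (logConst m ℓ : ℂ)
      = rapidityConst m ℓ + (Real.log 2 + Real.eulerMascheroniConstant) := by
    have h4 := Real.exp_pos Real.eulerMascheroniConstant
    rw [← ofReal_add, ← ofReal_add, logConst, rapidityConst, ← add_assoc,
      ← Real.log_mul (by positivity) two_ne_zero, Real.log_mul (by positivity) (Real.exp_pos _).ne',
      Real.log_exp, show m * ℓ / 2 * Real.exp Real.eulerMascheroniConstant * 2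
        = m * ℓ * Real.exp Real.eulerMascheroniConstant by ring,
      Real.log_mul (by positivity) h4.ne', Real.log_exp]
    push_cast
    ring
  have htanh : (Real.tanh (Real.pi * s) : ℂ) - Real.tanh (Real.pi * t)
      = Real.sinh (Real.pi * (s - t)) / (Real.cosh (Real.pi * s) * Real.cosh (Real.pi * t)) := by
    rw [mul_sub, ← ofReal_sub, tanh_sub_tanh, ofReal_div, ofReal_mul]
  have htanh' : (1 : ℂ) / (Real.cosh (Real.pi * s) * Real.cosh (Real.pi * t))
      = (Real.tanh (Real.pi * s) - Real.tanh (Real.pi * t)) / Real.sinh (Real.pi * (s - t)) := by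
    rw [htanh, div_right_comm, div_self hr]
  rw [scalarKernel_eq_integral m hℓ, integral_rapidityKernel hm hℓ hst, mul_assoc (2 : ℂ),
    div_mul_eq_div_div I 2, hlog, shiftedDigamma, shiftedDigamma]
  generalize (Real.tanh (Real.pi * s) : ℂ) = S at htanh' ⊢
  generalize (Real.tanh (Real.pi * t) : ℂ) = T at htanh' ⊢
  generalize (Real.sinh (Real.pi * (s - t)) : ℂ) = R at hr htanh' ⊢
  generalize (Real.cosh (Real.pi * s) : ℂ) * (Real.cosh (Real.pi * t) : ℂ) = C at htanh' ⊢
  rw [div_eq_mul_one_div _ C, div_eq_mul_one_div _ (2 * C), ← one_div_mul_one_div_rev,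
    htanh']
  field_simp
  ring

/-! ### Smoothness and a criterion for Schwartz functions -/

/-- The bilinear pairing `(u, v), (s, t) ↦ (v t - u s) / π`. With the convention
`x ↦ exp (2 π i x)` for the Fourier character, evaluated at minus the pairing, the phase is
`exp (2 i s u - 2 i t v)`. -/
noncomputable def phasePairing : (ℝ × ℝ) →L[ℝ] (ℝ × ℝ) →L[ℝ] ℝ :=
  (1 / Real.pi) • ((ContinuousLinearMap.mul ℝ ℝ).bilinearComp (ContinuousLinearMap.snd ℝ ℝ ℝ)
      (ContinuousLinearMap.snd ℝ ℝ ℝ)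
    - (ContinuousLinearMap.mul ℝ ℝ).bilinearComp (ContinuousLinearMap.fst ℝ ℝ ℝ)
      (ContinuousLinearMap.fst ℝ ℝ ℝ))

/-- The pairing `(u, v), s ↦ -u s / π`: the part of `phasePairing` relevant when only the first
spectral variable is transformed. -/
noncomputable def phasePairingFst : (ℝ × ℝ) →L[ℝ] ℝ →L[ℝ] ℝ :=
  (-(1 / Real.pi)) • (ContinuousLinearMap.mul ℝ ℝ).comp (ContinuousLinearMap.fst ℝ ℝ ℝ)

theorem fourierChar_smul_eq {x y : ℝ} (z : ℂ) (h : 2 * Real.pi * x = y) :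
    Real.fourierChar x • z = cexp (y * I) * z := by
  rw [Circle.smul_def, Real.fourierChar_apply, smul_eq_mul, ← h]

theorem contDiff_scalarKernel {m ℓ : ℝ} (hm : 0 < m) (hℓ : 0 < ℓ) :
    ContDiff ℝ (⊤ : ℕ∞) (fun p : ℝ × ℝ => scalarKernel m ℓ p.1 p.2) := by
  have h := VectorFourier.contDiff_fourierIntegral phasePairing (μ := volume)
    (f := fun p => (rapidityKernel m ℓ p : ℂ)) (N := ⊤) (fun n _ => by
      simpa only [norm_real, Real.norm_eq_abs] using integrable_pow_mul_rapidityKernel hm hℓ n)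
  have heq : (fun p : ℝ × ℝ => scalarKernel m ℓ p.1 p.2) = fun q => I / (2 * Real.pi ^ 2)
      * VectorFourier.fourierIntegral Real.fourierChar volume phasePairing.toLinearMap₁₂
        (fun p => (rapidityKernel m ℓ p : ℂ)) q := by
    ext q
    rw [scalarKernel_eq_integral m hℓ, VectorFourier.fourierIntegral]
    congr 1
    refine integral_congr_ae (ae_of_all _ fun p => ?_)
    have hpi := Real.pi_ne_zero
    simp only
    rw [fourierChar_smul_eq (y := 2 * (q.1 * p.1) - 2 * (q.2 * p.2)), mul_comm, ← Complex.exp_add]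
    · congr 2
      push_cast
      ring
    · simp [phasePairing]
      field_simp
      ring
  rw [heq]
  exact contDiff_const.mul h

/-- For fixed `t` the kernel is the Fourier transform of a function with integrable moments, so
each of its derivatives in `s` is bounded. -/
theorem norm_iteratedFDeriv_scalarKernel_le {m ℓ : ℝ} (hm : 0 < m) (hℓ : 0 < ℓ) (t : ℝ) (n : ℕ) :
    ∃ C : ℝ, ∀ s, ‖iteratedFDeriv ℝ n (fun s => scalarKernel m ℓ s t) s‖ ≤ C := by
  set f : ℝ × ℝ → ℂ := fun p => I / (2 * Real.pi ^ 2) * ((rapidityKernel m ℓ p : ℂ)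
    * cexp (-(2 * I * t * p.2))) with hf
  have hfm : Measurable f := by
    have := measurable_rapidityKernel m ℓ
    rw [hf]
    fun_prop
  have hint : ∀ n : ℕ, Integrable fun p => ‖p‖ ^ n * ‖f p‖ := by
    intro n
    refine ((integrable_pow_mul_rapidityKernel hm hℓ n).const_mul ‖I / (2 * Real.pi ^ 2 : ℂ)‖).congr
      (ae_of_all _ fun p => ?_)
    simp only [hf]
    rw [norm_mul, norm_mul, norm_exp_two_I_neg, norm_real, Real.norm_eq_abs]
    ring
  have hK : (fun s => scalarKernel m ℓ s t) = VectorFourier.fourierIntegral Real.fourierChar volume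
      phasePairingFst.toLinearMap₁₂ f := by
    ext s
    rw [scalarKernel_eq_integral m hℓ, VectorFourier.fourierIntegral, ← integral_const_mul]
    refine integral_congr_ae (ae_of_all _ fun p => ?_)
    have hpi := Real.pi_ne_zero
    simp only
    rw [fourierChar_smul_eq (y := 2 * (s * p.1)), hf]
    · simp only
      rw [show ((2 * (s * p.1) : ℝ) : ℂ) * I = 2 * I * s * p.1 by push_cast; ring]
      ring
    · simp [phasePairingFst]
      field_simp
  refine ⟨∫ p, ‖VectorFourier.fourierPowSMulRight phasePairingFst f p n‖, fun s => ?_⟩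
  rw [hK, VectorFourier.iteratedFDeriv_fourierIntegral (N := ⊤) phasePairingFst
    (fun n _ => hint n) hfm.aestronglyMeasurable le_top]
  exact VectorFourier.norm_fourierIntegral_le_integral_norm _ _ _ _ _

/-- An inequality of Landau type: if `f` decays exponentially and `f''` is bounded, then `f'`
decays exponentially, at half the rate. -/
theorem norm_deriv_le_of_norm_le_exp {f f' f'' : ℝ → ℂ} {C c M : ℝ} (hc : 0 < c)
    (hf : ∀ x, HasDerivAt f (f' x) x) (hf' : ∀ x, HasDerivAt f' (f'' x) x)
    (h0 : ∀ x, ‖f x‖ ≤ C * Real.exp (-(c * |x|))) (h2 : ∀ x, ‖f'' x‖ ≤ M) (x : ℝ) :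
    ‖f' x‖ ≤ (C * Real.exp c + C + M) * Real.exp (-(c / 2 * |x|)) := by
  -- The step `h` of the difference quotient balances `f = O(h ^ 2)` against the remainder
  -- `M h ^ 2`.
  set h := Real.exp (-(c / 2 * |x|)) with hh
  have hpos : 0 < h := Real.exp_pos _
  have hle : h ≤ 1 := Real.exp_le_one_iff.2 (by have := abs_nonneg x; nlinarith)
  have hC : 0 ≤ C := by
    have := (norm_nonneg _).trans (h0 0)
    simpa using this
  have hh2 : Real.exp (-(c * |x|)) = h * h := by rw [hh, ← Real.exp_add]; ring_nf
  have key : ‖f (x + h) - f x - h • f' x‖ ≤ M * h * h := by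
    have h3 : ∀ y ∈ Icc x (x + h), HasDerivWithinAt (fun y => f y - (y - x) • f' x)
        (f' y - f' x) (Icc x (x + h)) y := by
      intro y _
      have h4 := (hf y).sub (((hasDerivAt_id y).sub_const x).smul_const (f' x))
      simp only [one_smul] at h4
      exact h4.hasDerivWithinAt
    have h5 : ∀ y ∈ Ico x (x + h), ‖f' y - f' x‖ ≤ M * h := by
      intro y hy
      have h6 := Convex.norm_image_sub_le_of_norm_hasDerivWithin_le (s := univ) (x := x) (y := y)
        (fun z _ => (hf' z).hasDerivWithinAt) (fun z _ => h2 z) convex_univ (mem_univ _)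
        (mem_univ _)
      refine h6.trans ?_
      have hM : 0 ≤ M := (norm_nonneg _).trans (h2 0)
      gcongr
      rw [Real.norm_eq_abs, abs_of_nonneg (by linarith [hy.1])]
      linarith [hy.2]
    have h7 := norm_image_sub_le_of_norm_deriv_le_segment' h3 h5 (x + h) ⟨by linarith, le_rfl⟩
    simpa [sub_right_comm] using h7
  have h8 : ‖f (x + h)‖ ≤ C * Real.exp c * (h * h) := by
    refine (h0 _).trans ?_
    rw [← hh2, mul_assoc, ← Real.exp_add]
    gcongr
    have : |x| ≤ |x + h| + 1 := by
      have := abs_sub (x + h) h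
      rw [add_sub_cancel_right, abs_of_pos hpos] at this
      linarith
    nlinarith
  have h9 : ‖f x‖ ≤ C * (h * h) := by rw [← hh2]; exact h0 x
  have h10 : ‖h • f' x‖ ≤ ‖f (x + h)‖ + ‖f x‖ + ‖f (x + h) - f x - h • f' x‖ := by
    have e : h • f' x = f (x + h) - f x - (f (x + h) - f x - h • f' x) := by abel
    calc ‖h • f' x‖ = ‖f (x + h) - f x - (f (x + h) - f x - h • f' x)‖ := by rw [← e]
      _ ≤ ‖f (x + h) - f x‖ + _ := norm_sub_le _ _
      _ ≤ _ := by gcongr; exact norm_sub_le _ _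
  rw [norm_smul, Real.norm_eq_abs, abs_of_pos hpos] at h10
  refine le_of_mul_le_mul_left ?_ hpos
  linarith

/-- A smooth function that decays exponentially and has bounded derivatives is a Schwartz function:
by `norm_deriv_le_of_norm_le_exp` all its derivatives decay exponentially. -/
theorem exists_schwartzMap {f : ℝ → ℂ} (hf : ContDiff ℝ (⊤ : ℕ∞) f)
    (hb : ∀ n : ℕ, ∃ C : ℝ, ∀ x, ‖iteratedFDeriv ℝ n f x‖ ≤ C) {C : ℝ}
    (h0 : ∀ x, ‖f x‖ ≤ C * Real.exp (-|x|)) : ∃ g : SchwartzMap ℝ ℂ, ∀ x, g x = f x := by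
  have hd : ∀ (n : ℕ) (x : ℝ), HasDerivAt (iteratedDeriv n f) (iteratedDeriv (n + 1) f x) x := by
    intro n x
    rw [iteratedDeriv_succ]
    exact ((hf.differentiable_iteratedDeriv n
      (by exact_mod_cast ENat.natCast_lt_top n)) x).hasDerivAt
  have hexp : ∀ n : ℕ, ∃ C c : ℝ, 0 < c ∧ ∀ x,
      ‖iteratedDeriv n f x‖ ≤ C * Real.exp (-(c * |x|)) := by
    intro n
    induction n with
    | zero => exact ⟨C, 1, one_pos, fun x => by simpa using h0 x⟩
    | succ n ih =>
      obtain ⟨C, c, hc, h⟩ := ih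
      obtain ⟨M, hM⟩ := hb (n + 2)
      exact ⟨C * Real.exp c + C + M, c / 2, half_pos hc,
        norm_deriv_le_of_norm_le_exp hc (hd n) (hd (n + 1)) h fun x => by
          rw [← norm_iteratedFDeriv_eq_norm_iteratedDeriv]; exact hM x⟩
  refine ⟨⟨f, hf, fun k n => ?_⟩, fun x => rfl⟩
  obtain ⟨C, c, hc, h⟩ := hexp n
  refine ⟨C * (k.factorial / c ^ k), fun x => ?_⟩
  rw [norm_iteratedFDeriv_eq_norm_iteratedDeriv, Real.norm_eq_abs]
  have hC : 0 ≤ C := by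
    have := (norm_nonneg _).trans (h 0)
    simpa using this
  have h1 := Real.pow_div_factorial_le_exp _ (show 0 ≤ c * |x| by positivity) k
  rw [div_le_iff₀ (by positivity), mul_pow] at h1
  have h2 : |x| ^ k ≤ k.factorial / c ^ k * Real.exp (c * |x|) := by
    rw [div_mul_eq_mul_div, le_div_iff₀ (by positivity)]
    linarith
  calc |x| ^ k * ‖iteratedDeriv n f x‖
      ≤ (k.factorial / c ^ k * Real.exp (c * |x|)) * (C * Real.exp (-(c * |x|))) := by
        gcongr
        exact h x
    _ = C * (k.factorial / c ^ k) * (Real.exp (c * |x|) * Real.exp (-(c * |x|))) := by ring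
    _ = _ := by rw [← Real.exp_add]; simp

/-! ### Increments of the digamma sum -/

theorem self_mul_inv_sinh_le {w : ℝ} (hw : 0 < w) :
    w * (Real.sinh w)⁻¹ ≤ 2 * (1 + w) * Real.exp (-w) := by
  have hs : 0 < Real.sinh w := Real.sinh_pos_iff.2 hw
  rw [← div_eq_mul_inv, div_le_iff₀ hs, Real.sinh_eq]
  have h1 : Real.exp w * Real.exp (-w) = 1 := by rw [← Real.exp_add]; simp
  have h2 := Real.exp_pos (-w)
  have h3 := Real.add_one_le_exp w
  have h4 : Real.exp (-w) ≤ 1 := Real.exp_le_one_iff.2 (by linarith)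
  have h5 : (1 + w) * Real.exp (-w) ≤ 1 := by
    rw [← h1]; gcongr; linarith
  have h6 : (1 + w) * Real.exp (-w) * Real.exp (-w) ≤ 1 := by nlinarith
  have : 2 * (1 + w) * Real.exp (-w) * ((Real.exp w - Real.exp (-w)) / 2)
      = (1 + w) * (Real.exp w * Real.exp (-w)) - (1 + w) * Real.exp (-w) * Real.exp (-w) := by ring
  rw [this, h1]
  linarith

theorem self_mul_inv_sinh_le' {w : ℝ} (hw : 0 < w) :
    w * (Real.sinh w)⁻¹ ≤ 4 * Real.exp (-(1 / 2) * w) := by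
  refine (self_mul_inv_sinh_le hw).trans ?_
  have h1 := Real.add_one_le_exp (w / 2)
  have h2 : Real.exp (-(1 / 2) * w) = Real.exp (w / 2) * Real.exp (-w) := by
    rw [← Real.exp_add]; ring_nf
  have h3 := Real.exp_pos (-w)
  rw [h2, ← mul_assoc]
  refine mul_le_mul_of_nonneg_right ?_ h3.le
  linarith

theorem sq_mul_inv_sinh_le {w : ℝ} (hw : 0 < w) :
    w ^ 2 * (Real.sinh w)⁻¹ ≤ 32 * Real.exp (-(1 / 2) * w) := by
  have h1 := Real.add_one_le_exp (w / 4)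
  have h2 : Real.exp (-(1 / 2) * w) = (Real.exp (w / 4) * Real.exp (w / 4)) * Real.exp (-w) := by
    rw [← Real.exp_add, ← Real.exp_add]; ring_nf
  have h3 := Real.exp_pos (-w)
  calc w ^ 2 * (Real.sinh w)⁻¹ = w * (w * (Real.sinh w)⁻¹) := by ring
    _ ≤ w * (2 * (1 + w) * Real.exp (-w)) :=
      mul_le_mul_of_nonneg_left (self_mul_inv_sinh_le hw) hw.le
    _ = (2 * (w * (1 + w))) * Real.exp (-w) := by ring
    _ ≤ (2 * ((4 * Real.exp (w / 4)) * (4 * Real.exp (w / 4)))) * Real.exp (-w) := by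
      gcongr <;> linarith
    _ = _ := by rw [h2]; ring

theorem integrableOn_exp_half (c : ℝ) :
    IntegrableOn (fun w : ℝ => c * Real.exp (-(1 / 2) * w)) (Ioi 0) :=
  (exp_neg_integrableOn_Ioi 0 (by norm_num)).const_mul c

theorem integral_exp_half (c : ℝ) :
    ∫ w in Ioi (0 : ℝ), c * Real.exp (-(1 / 2) * w) = 2 * c := by
  rw [integral_const_mul, integral_exp_mul_Ioi (by norm_num)]
  simp
  ring

theorem abs_inv_sinh_mul_sin_le {w : ℝ} (hw : 0 < w) (τ : ℝ) :
    |(Real.sinh w)⁻¹ * Real.sin (τ * w)| ≤ |τ| * (w * (Real.sinh w)⁻¹) := by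
  have hs := inv_pos.2 (Real.sinh_pos_iff.2 hw)
  rw [abs_mul, abs_of_pos hs]
  calc _ ≤ (Real.sinh w)⁻¹ * (|τ| * w) := by gcongr; exact abs_sin_le_self_mul hw
    _ = _ := by ring

theorem abs_integral_sin_sin_le (σ τ : ℝ) :
    |∫ w in Ioi (0 : ℝ), (Real.sinh w)⁻¹ * (2 * Real.sin (σ * w) * Real.sin (τ * w))|
      ≤ 16 * |τ| := by
  rw [← Real.norm_eq_abs]
  have h := norm_integral_le_of_norm_le (integrableOn_exp_half (8 * |τ|))
    (μ := volume.restrict (Ioi (0 : ℝ)))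
    (f := fun w => (Real.sinh w)⁻¹ * (2 * Real.sin (σ * w) * Real.sin (τ * w)))
    ((ae_restrict_iff' measurableSet_Ioi).2 (ae_of_all _ fun w hw => ?_))
  · rw [integral_exp_half] at h
    linarith
  · have h1 := abs_inv_sinh_mul_sin_le hw τ
    have h2 := self_mul_inv_sinh_le' hw
    have h3 := Real.abs_sin_le_one (σ * w)
    have h4 := abs_nonneg τ
    rw [Real.norm_eq_abs, show (Real.sinh w)⁻¹ * (2 * Real.sin (σ * w) * Real.sin (τ * w))
      = 2 * Real.sin (σ * w) * ((Real.sinh w)⁻¹ * Real.sin (τ * w)) by ring, abs_mul, abs_mul,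
      abs_two]
    calc _ ≤ 2 * 1 * (|τ| * (4 * Real.exp (-(1 / 2) * w))) := by
          gcongr
          exact h1.trans (by gcongr)
      _ = _ := by ring

/-- The numerator of the derivative of `sin (τ w) / sinh w` vanishes to third order at `w = 0`; the
bound follows from its own derivative, `-(1 + τ ^ 2) sin (τ w) sinh w`. -/
theorem abs_sin_quotient_numerator_le (τ : ℝ) {w : ℝ} (hw : 0 ≤ w) :
    |τ * Real.cos (τ * w) * Real.sinh w - Real.sin (τ * w) * Real.cosh w|
      ≤ (1 + τ ^ 2) * |τ| * w * Real.sinh w * w := by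
  have hd : ∀ x : ℝ, HasDerivAt
      (fun x => τ * Real.cos (τ * x) * Real.sinh x - Real.sin (τ * x) * Real.cosh x)
      (-((1 + τ ^ 2) * Real.sin (τ * x) * Real.sinh x)) x := by
    intro x
    have h0 := (hasDerivAt_id x).const_mul τ
    have h1 := ((h0.cos.const_mul τ).mul (Real.hasDerivAt_sinh x)).sub
      (h0.sin.mul (Real.hasDerivAt_cosh x))
    refine h1.congr_deriv ?_
    simp only [id]
    ring
  have h := norm_image_sub_le_of_norm_deriv_le_segment' (C := (1 + τ ^ 2) * |τ| * w * Real.sinh w)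
    (fun x (_ : x ∈ Icc 0 w) => (hd x).hasDerivWithinAt) (fun x hx => ?_) w ⟨hw, le_rfl⟩
  · simpa using h
  · have hx0 : 0 ≤ Real.sinh x := Real.sinh_nonneg_iff.2 hx.1
    have hxw : Real.sinh x ≤ Real.sinh w := Real.sinh_le_sinh.2 hx.2.le
    have h3 : |Real.sin (τ * x)| ≤ |τ| * w := by
      refine Real.abs_sin_le_abs.trans ?_
      rw [abs_mul, abs_of_nonneg hx.1]
      gcongr
      exact hx.2.le
    rw [norm_neg, Real.norm_eq_abs, abs_mul, abs_mul, abs_of_nonneg hx0,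
      abs_of_pos (by positivity : 0 < 1 + τ ^ 2)]
    calc _ ≤ (1 + τ ^ 2) * (|τ| * w) * Real.sinh w := by gcongr
      _ = _ := by ring

/-- Integration by parts against `σ sin (σ w) = (1 - cos (σ w))'` gains the decay in `σ`. The
boundary term at `0` vanishes because `1 - cos (σ w)` does. -/
theorem abs_mul_abs_integral_sin_sin_le (σ τ : ℝ) :
    |σ| * |∫ w in Ioi (0 : ℝ), (Real.sinh w)⁻¹ * (2 * Real.sin (σ * w) * Real.sin (τ * w))|
      ≤ 256 * ((1 + τ ^ 2) * |τ|) := by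
  set g : ℝ → ℝ := fun w => (Real.sinh w)⁻¹ * Real.sin (τ * w) with hg
  set g' : ℝ → ℝ := fun w =>
    (τ * Real.cos (τ * w) * Real.sinh w - Real.sin (τ * w) * Real.cosh w) / Real.sinh w ^ 2 with hg'
  set v : ℝ → ℝ := fun w => 1 - Real.cos (σ * w) with hv
  have hgd : ∀ w ∈ Ioi (0 : ℝ), HasDerivAt g (g' w) w := by
    intro w hw
    have hs : Real.sinh w ≠ 0 := (Real.sinh_pos_iff.2 hw).ne'
    have h1 := ((Real.hasDerivAt_sinh w).inv hs).mul ((hasDerivAt_id w).const_mul τ).sin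
    refine h1.congr_deriv ?_
    simp only [id, hg', Pi.inv_apply]
    field_simp
    ring
  have hvd : ∀ w ∈ Ioi (0 : ℝ), HasDerivAt v (σ * Real.sin (σ * w)) w := by
    intro w _
    have h1 := (((hasDerivAt_id w).const_mul σ).cos).const_sub 1
    refine h1.congr_deriv ?_
    simp only [id]
    ring
  have hvb : ∀ w, |v w| ≤ 2 := by
    intro w
    have := Real.neg_one_le_cos (σ * w)
    have := Real.cos_le_one (σ * w)
    rw [abs_le]
    constructor <;> simp only [hv] <;> linarith
  have hgb : ∀ w ∈ Ioi (0 : ℝ), |g w| ≤ |τ| * (4 * Real.exp (-(1 / 2) * w)) := by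
    intro w hw
    refine (abs_inv_sinh_mul_sin_le hw τ).trans ?_
    exact mul_le_mul_of_nonneg_left (self_mul_inv_sinh_le' hw) (abs_nonneg τ)
  have hgb' : ∀ w ∈ Ioi (0 : ℝ), |g' w| ≤ (1 + τ ^ 2) * |τ| * (32 * Real.exp (-(1 / 2) * w)) := by
    intro w hw
    have hs : 0 < Real.sinh w := Real.sinh_pos_iff.2 hw
    simp only [hg']
    rw [abs_div, abs_of_pos (by positivity : 0 < Real.sinh w ^ 2)]
    calc _ ≤ ((1 + τ ^ 2) * |τ| * w * Real.sinh w * w) / Real.sinh w ^ 2 := by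
          gcongr
          exact abs_sin_quotient_numerator_le τ (le_of_lt hw)
      _ = (1 + τ ^ 2) * |τ| * (w ^ 2 * (Real.sinh w)⁻¹) := by field_simp
      _ ≤ _ := by
          exact mul_le_mul_of_nonneg_left (sq_mul_inv_sinh_le hw) (by positivity)
  have hgm : Measurable g := by rw [hg]; fun_prop
  have hgm' : Measurable g' := by rw [hg']; fun_prop
  have hvm : Measurable v := by rw [hv]; fun_prop
  have hbound : ∀ w ∈ Ioi (0 : ℝ), ‖(g' * v) w‖
      ≤ (64 * ((1 + τ ^ 2) * |τ|)) * Real.exp (-(1 / 2) * w) := by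
    intro w hw
    rw [Pi.mul_apply, norm_mul, Real.norm_eq_abs, Real.norm_eq_abs]
    calc _ ≤ ((1 + τ ^ 2) * |τ| * (32 * Real.exp (-(1 / 2) * w))) * 2 := by
          gcongr
          · exact hgb' w hw
          · exact hvb w
      _ = _ := by ring
  have i1 : IntegrableOn (g * fun w => σ * Real.sin (σ * w)) (Ioi 0) := by
    refine (integrableOn_exp_half (|σ| * |τ| * 4)).mono'
      (hgm.mul (by fun_prop)).aestronglyMeasurable
      ((ae_restrict_iff' measurableSet_Ioi).2 (ae_of_all _ fun w hw => ?_))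
    rw [Pi.mul_apply, Real.norm_eq_abs, abs_mul, abs_mul σ]
    calc _ ≤ (|τ| * (4 * Real.exp (-(1 / 2) * w))) * (|σ| * 1) := by
          gcongr ?_ * (_ * ?_)
          · exact hgb w hw
          · exact Real.abs_sin_le_one _
      _ = _ := by ring
  have i2 : IntegrableOn (g' * v) (Ioi 0) :=
    (integrableOn_exp_half (64 * ((1 + τ ^ 2) * |τ|))).mono' (hgm'.mul hvm).aestronglyMeasurable
      ((ae_restrict_iff' measurableSet_Ioi).2 (ae_of_all _ hbound))
  have l1 : Tendsto (g * v) (𝓝[>] 0) (𝓝 0) := by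
    have hv0 : Tendsto (fun w => |τ| * 4 * |v w|) (𝓝[>] 0) (𝓝 0) := by
      have : Continuous fun w => |τ| * 4 * |v w| := by rw [hv]; fun_prop
      have := (this.tendsto 0).mono_left (nhdsWithin_le_nhds (s := Ioi 0))
      simpa [hv] using this
    refine squeeze_zero_norm' ?_ hv0
    filter_upwards [self_mem_nhdsWithin] with w hw
    rw [Pi.mul_apply, norm_mul, Real.norm_eq_abs, Real.norm_eq_abs]
    gcongr
    refine (hgb w hw).trans ?_
    gcongr
    have : Real.exp (-(1 / 2) * w) ≤ 1 := Real.exp_le_one_iff.2 (by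
      have : 0 < w := hw
      linarith)
    linarith
  have l2 : Tendsto (g * v) atTop (𝓝 0) := by
    have he : Tendsto (fun w : ℝ => |τ| * (4 * Real.exp (-(1 / 2) * w)) * 2) atTop (𝓝 0) := by
      have h1 : Tendsto (fun w : ℝ => Real.exp (-(1 / 2) * w)) atTop (𝓝 0) :=
        Real.tendsto_exp_atBot.comp (tendsto_id.const_mul_atTop_of_neg (by norm_num))
      simpa using ((h1.const_mul 4).const_mul |τ|).mul_const 2
    refine squeeze_zero_norm' ?_ he
    filter_upwards [Ioi_mem_atTop 0] with w hw
    rw [Pi.mul_apply, norm_mul, Real.norm_eq_abs, Real.norm_eq_abs]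
    gcongr
    · exact hgb w hw
    · exact hvb w
  have ibp := integral_Ioi_mul_deriv_eq_deriv_mul hgd hvd i1 i2 l1 l2
  have hnorm := norm_integral_le_of_norm_le (integrableOn_exp_half (64 * ((1 + τ ^ 2) * |τ|)))
    ((ae_restrict_iff' measurableSet_Ioi).2 (ae_of_all _ hbound))
  rw [integral_exp_half, Real.norm_eq_abs] at hnorm
  have heq : σ * ∫ w in Ioi (0 : ℝ), (Real.sinh w)⁻¹ * (2 * Real.sin (σ * w) * Real.sin (τ * w))
      = -2 * ∫ w in Ioi (0 : ℝ), (g' * v) w := by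
    have h1 : ∫ w in Ioi (0 : ℝ), (g' * v) w = ∫ w in Ioi (0 : ℝ), g' w * v w := rfl
    have h2 : ∀ w, σ * ((Real.sinh w)⁻¹ * (2 * Real.sin (σ * w) * Real.sin (τ * w)))
        = 2 * (g w * (σ * Real.sin (σ * w))) := fun w => by simp only [hg]; ring
    rw [← integral_const_mul]
    simp only [h2]
    rw [integral_const_mul, ibp, h1]
    ring
  rw [← abs_mul, heq, abs_mul, abs_neg, abs_two]
  linarith

/-- The digamma sum grows only logarithmically; this weak form of that fact is all that the decay
of `K` needs: the increment over a bounded distance is `O(1 / (1 + |s + t|))`. -/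
theorem norm_digammaSum_sub_le (s t : ℝ) :
    (1 + |s + t|) * ‖digammaSum s - digammaSum t‖ ≤ 544 * ((1 + (s - t) ^ 2) * |s - t|) := by
  have h1 := abs_integral_sin_sin_le (s + t) (s - t)
  have h2 := abs_mul_abs_integral_sin_sin_le (s + t) (s - t)
  rw [digammaSum_sub, norm_real, Real.norm_eq_abs, abs_mul, abs_two]
  have h3 : |s - t| ≤ (1 + (s - t) ^ 2) * |s - t| :=
    le_mul_of_one_le_left (abs_nonneg _) (by linarith [sq_nonneg (s - t)])
  linarith

/-! ### Decay of the kernel -/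

theorem exists_one_add_pow_mul_exp_le (n : ℕ) {c d : ℝ} (h : c < d) :
    ∃ C : ℝ, 0 ≤ C ∧ ∀ x : ℝ, 0 ≤ x →
      (1 + x) ^ n * Real.exp (-(d * x)) ≤ C * Real.exp (-(c * x)) := by
  have hδ : 0 < d - c := sub_pos.2 h
  refine ⟨n.factorial / (d - c) ^ n * Real.exp (d - c), by positivity, fun x hx => ?_⟩
  have h1 := Real.pow_div_factorial_le_exp _ (show 0 ≤ (d - c) * (1 + x) by positivity) n
  rw [div_le_iff₀ (by positivity), mul_pow] at h1
  have h2 : (1 + x) ^ n ≤ n.factorial / (d - c) ^ n * Real.exp ((d - c) * (1 + x)) := by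
    rw [div_mul_eq_mul_div, le_div_iff₀ (by positivity)]
    linarith
  calc _ ≤ n.factorial / (d - c) ^ n * Real.exp ((d - c) * (1 + x)) * Real.exp (-(d * x)) := by
        gcongr
    _ = _ := by
        rw [mul_assoc, mul_assoc, ← Real.exp_add, ← Real.exp_add]
        ring_nf

/-- Replacing `tanh (π t)` by `tanh (π s)` in the explicit form splits the kernel into a part
concentrated at the origin, with weight `1 / (cosh (π s) cosh (π t))`, and a part concentrated near
the diagonal, which contains an increment of the digamma sum over `sinh (π (s - t))`. -/
theorem norm_scalarKernel_le_of_ne {m ℓ : ℝ} (hm : 0 < m) (hℓ : 0 < ℓ) {s t : ℝ} (hst : s ≠ t) :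
    ‖scalarKernel m ℓ s t‖ ≤ (|logConst m ℓ| / 2 + ‖digammaSum s‖ / 4)
        * ((Real.cosh (Real.pi * s))⁻¹ * (Real.cosh (Real.pi * t))⁻¹)
      + ‖digammaSum s - digammaSum t‖ / 4 * (Real.sinh (Real.pi * |s - t|))⁻¹ := by
  have hs : (Real.cosh (Real.pi * s) : ℂ) ≠ 0 := ofReal_ne_zero.2 (Real.cosh_pos _).ne'
  have ht : (Real.cosh (Real.pi * t) : ℂ) ≠ 0 := ofReal_ne_zero.2 (Real.cosh_pos _).ne'
  have hr : (Real.sinh (Real.pi * (s - t)) : ℂ) ≠ 0 := ofReal_ne_zero.2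
    (Real.sinh_ne_zero.2 (mul_ne_zero Real.pi_ne_zero (sub_ne_zero.2 hst)))
  have htanh : (Real.tanh (Real.pi * t) : ℂ) = Real.tanh (Real.pi * s)
      - Real.sinh (Real.pi * (s - t)) / (Real.cosh (Real.pi * s) * Real.cosh (Real.pi * t)) := by
    rw [eq_sub_iff_add_eq, ← eq_sub_iff_add_eq', mul_sub, ← ofReal_sub, tanh_sub_tanh, ofReal_div,
      ofReal_mul]
  have hK : scalarKernel m ℓ s t = I * ((logConst m ℓ / 2 + digammaSum s / 4)
        * ((Real.cosh (Real.pi * s) : ℂ)⁻¹ * (Real.cosh (Real.pi * t) : ℂ)⁻¹)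
      - Real.tanh (Real.pi * s) * ((digammaSum s - digammaSum t) / 4
        * (Real.sinh (Real.pi * (s - t)) : ℂ)⁻¹)) := by
    rw [scalarKernel_of_ne hm hℓ hst, htanh]
    field_simp
    ring
  have hnormR : ‖(Real.sinh (Real.pi * (s - t)) : ℂ)⁻¹‖ = (Real.sinh (Real.pi * |s - t|))⁻¹ := by
    rw [norm_inv, norm_real, Real.norm_eq_abs, Real.abs_sinh, abs_mul, abs_of_pos Real.pi_pos]
  have hnormC : ∀ x : ℝ, ‖(Real.cosh x : ℂ)⁻¹‖ = (Real.cosh x)⁻¹ := fun x => by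
    rw [norm_inv, norm_real, Real.norm_eq_abs, abs_of_pos (Real.cosh_pos x)]
  have hT : ‖(Real.tanh (Real.pi * s) : ℂ)‖ ≤ 1 := by
    rw [norm_real, Real.norm_eq_abs]
    exact (Real.abs_tanh_lt_one _).le
  have h1 : ‖(logConst m ℓ / 2 + digammaSum s / 4 : ℂ)‖
      ≤ |logConst m ℓ| / 2 + ‖digammaSum s‖ / 4 := by
    refine (norm_add_le _ _).trans_eq ?_
    simp
  have hc := inv_pos.2 (Real.cosh_pos (Real.pi * s))
  have hc' := inv_pos.2 (Real.cosh_pos (Real.pi * t))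
  rw [hK, norm_mul, norm_I, one_mul]
  refine (norm_sub_le _ _).trans ?_
  rw [norm_mul, norm_mul, hnormC, hnormC, norm_mul, norm_mul, hnormR, norm_div]
  have h4 : ‖(4 : ℂ)‖ = 4 := by simp
  rw [h4]
  have h5 : 0 ≤ ‖digammaSum s - digammaSum t‖ / 4 * (Real.sinh (Real.pi * |s - t|))⁻¹ := by
    have : 0 ≤ Real.sinh (Real.pi * |s - t|) :=
      Real.sinh_nonneg_iff.2 (mul_nonneg Real.pi_pos.le (abs_nonneg _))
    positivity
  exact add_le_add (mul_le_mul_of_nonneg_right h1 (by positivity)) (mul_le_of_le_one_left h5 hT)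

theorem norm_digammaSum_le (s : ℝ) :
    ‖digammaSum s‖ ≤ (‖digammaSum 0‖ + 544) * (1 + |s|) ^ 3 := by
  have h := norm_digammaSum_sub_le s 0
  have ha := abs_nonneg s
  rw [add_zero, sub_zero, ← sq_abs] at h
  have h1 : ‖digammaSum s‖ ≤ ‖digammaSum 0‖ + ‖digammaSum s - digammaSum 0‖ := by
    have := norm_add_le (digammaSum 0) (digammaSum s - digammaSum 0)
    rwa [add_sub_cancel] at this
  have h2 : ‖digammaSum s - digammaSum 0‖ ≤ 544 * ((1 + |s| ^ 2) * |s|) :=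
    (le_mul_of_one_le_left (norm_nonneg _) (by linarith)).trans h
  have h3 : 1 ≤ (1 + |s|) ^ 3 := one_le_pow₀ (by linarith)
  have h4 : (1 + |s| ^ 2) * |s| ≤ (1 + |s|) ^ 3 := by nlinarith [pow_nonneg ha 2]
  have h5 := norm_nonneg (digammaSum 0)
  nlinarith

/-- Bound for the part of the kernel concentrated at the origin. -/
theorem originTerm_le {A D E c : ℝ} (hA : 0 ≤ A) (hc0 : 0 ≤ c) (hD : D = ‖digammaSum 0‖ + 544)
    (hE0 : 0 ≤ E) (hE : ∀ x : ℝ, 0 ≤ x →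
      (1 + x) ^ 4 * Real.exp (-(Real.pi * x)) ≤ E * Real.exp (-(c * x))) (s t : ℝ) :
    (A + ‖digammaSum s‖ / 4) * ((Real.cosh (Real.pi * s))⁻¹ * (Real.cosh (Real.pi * t))⁻¹)
        * (1 + |s| + |t|) ≤ 4 * (A + D / 4) * E * Real.exp (-(c * |s - t|)) := by
  have ha := abs_nonneg s
  have hb := abs_nonneg t
  have hD0 : 0 ≤ D := by rw [hD]; positivity
  have e1 := inv_cosh_le (Real.pi * s)
  have e2 := inv_cosh_le (Real.pi * t)
  have e3 := inv_pos.2 (Real.cosh_pos (Real.pi * s))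
  have e4 := inv_pos.2 (Real.cosh_pos (Real.pi * t))
  rw [abs_mul, abs_of_pos Real.pi_pos] at e1 e2
  have hyx : |s - t| ≤ |s| + |t| := abs_sub s t
  rw [add_assoc 1]
  have hexp : Real.exp (-(Real.pi * |s|)) * Real.exp (-(Real.pi * |t|))
      = Real.exp (-(Real.pi * (|s| + |t|))) := by rw [← Real.exp_add]; ring_nf
  have hDs := norm_digammaSum_le s
  rw [← hD] at hDs
  have hsx : |s| ≤ |s| + |t| := by linarith
  have hx0 : 0 ≤ |s| + |t| := by positivity
  generalize |s| + |t| = x at *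
  generalize |s - t| = y at *
  have e5 : A + ‖digammaSum s‖ / 4 ≤ (A + D / 4) * (1 + x) ^ 3 := by
    have f1 : ‖digammaSum s‖ ≤ D * (1 + x) ^ 3 := hDs.trans (by gcongr)
    have f2 : A ≤ A * (1 + x) ^ 3 := le_mul_of_one_le_right hA (one_le_pow₀ (by linarith))
    linarith
  calc _ ≤ ((A + D / 4) * (1 + x) ^ 3) * ((2 * Real.exp (-(Real.pi * |s|)))
        * (2 * Real.exp (-(Real.pi * |t|)))) * (1 + x) := by gcongr
    _ = 4 * (A + D / 4) * ((1 + x) ^ 4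
        * (Real.exp (-(Real.pi * |s|)) * Real.exp (-(Real.pi * |t|)))) := by ring
    _ ≤ 4 * (A + D / 4) * (E * Real.exp (-(c * x))) := by
      rw [hexp]
      exact mul_le_mul_of_nonneg_left (hE x hx0) (by positivity)
    _ ≤ 4 * (A + D / 4) * (E * Real.exp (-(c * y))) := by gcongr
    _ = _ := by ring

/-- Bound for the part of the kernel concentrated near the diagonal. The vanishing of the increment
of the digamma sum compensates the pole of `1 / sinh (π (s - t))`, and
`1 + |s| + |t| ≤ (1 + |s + t|) (1 + |s - t|)`. -/
theorem diagonalTerm_le {E c : ℝ} (hE : ∀ x : ℝ, 0 ≤ x →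
      (1 + x) ^ 4 * Real.exp (-(Real.pi * x)) ≤ E * Real.exp (-(c * x))) {s t : ℝ} (hst : s ≠ t) :
    ‖digammaSum s - digammaSum t‖ / 4 * (Real.sinh (Real.pi * |s - t|))⁻¹ * (1 + |s| + |t|)
      ≤ 272 * E * Real.exp (-(c * |s - t|)) := by
  have hpi := Real.pi_pos
  have hy : 0 < |s - t| := abs_pos.2 (sub_ne_zero.2 hst)
  have f1 := norm_digammaSum_sub_le s t
  rw [← sq_abs (s - t)] at f1
  have f2 : 1 + |s| + |t| ≤ (1 + |s + t|) * (1 + |s - t|) := by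
    have g1 : 2 * |s| ≤ |s + t| + |s - t| := by
      have := abs_add_le (s + t) (s - t)
      rwa [show s + t + (s - t) = 2 * s by ring, abs_mul, abs_two] at this
    have g2 : 2 * |t| ≤ |s + t| + |s - t| := by
      have := abs_sub (s + t) (s - t)
      rwa [show s + t - (s - t) = 2 * t by ring, abs_mul, abs_two] at this
    have := mul_nonneg (abs_nonneg (s + t)) hy.le
    linarith
  generalize |s - t| = y at *
  have hsh : 0 < (Real.sinh (Real.pi * y))⁻¹ :=
    inv_pos.2 (Real.sinh_pos_iff.2 (mul_pos hpi hy))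
  have f3 : y * (Real.sinh (Real.pi * y))⁻¹ ≤ 2 * (1 + y) * Real.exp (-(Real.pi * y)) := by
    have g1 := self_mul_inv_sinh_le (mul_pos hpi hy)
    have g2 : 1 + Real.pi * y ≤ Real.pi * (1 + y) := by linarith [Real.pi_gt_three]
    refine le_of_mul_le_mul_left ?_ hpi
    calc _ = Real.pi * y * (Real.sinh (Real.pi * y))⁻¹ := by ring
      _ ≤ _ := g1
      _ ≤ 2 * (Real.pi * (1 + y)) * Real.exp (-(Real.pi * y)) := by gcongr
      _ = _ := by ring
  have f4 : (1 + y) * (1 + y ^ 2) * (1 + y) ≤ (1 + y) ^ 4 := by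
    have : 1 + y ^ 2 ≤ (1 + y) ^ 2 := by nlinarith
    calc _ ≤ (1 + y) * (1 + y) ^ 2 * (1 + y) := by gcongr
      _ = _ := by ring
  calc _ ≤ ‖digammaSum s - digammaSum t‖ / 4 * (Real.sinh (Real.pi * y))⁻¹
        * ((1 + |s + t|) * (1 + y)) := by gcongr
    _ = ((1 + |s + t|) * ‖digammaSum s - digammaSum t‖)
        * ((Real.sinh (Real.pi * y))⁻¹ * (1 + y) / 4) := by ring
    _ ≤ (544 * ((1 + y ^ 2) * y)) * ((Real.sinh (Real.pi * y))⁻¹ * (1 + y) / 4) := by gcongr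
    _ = 136 * ((1 + y) * (1 + y ^ 2)) * (y * (Real.sinh (Real.pi * y))⁻¹) := by ring
    _ ≤ 136 * ((1 + y) * (1 + y ^ 2)) * (2 * (1 + y) * Real.exp (-(Real.pi * y))) :=
      mul_le_mul_of_nonneg_left f3 (by positivity)
    _ = 272 * (((1 + y) * (1 + y ^ 2) * (1 + y)) * Real.exp (-(Real.pi * y))) := by ring
    _ ≤ 272 * ((1 + y) ^ 4 * Real.exp (-(Real.pi * y))) := by gcongr
    _ ≤ 272 * (E * Real.exp (-(c * y))) :=
      mul_le_mul_of_nonneg_left (hE y hy.le) (by norm_num)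
    _ = _ := by ring

theorem continuous_scalarKernel {m ℓ : ℝ} (hm : 0 < m) (hℓ : 0 < ℓ) :
    Continuous fun p : ℝ × ℝ => scalarKernel m ℓ p.1 p.2 :=
  (contDiff_scalarKernel hm hℓ).continuous

theorem continuous_scalarKernel_right {m ℓ : ℝ} (hm : 0 < m) (hℓ : 0 < ℓ) (s : ℝ) :
    Continuous (scalarKernel m ℓ s) := by
  have h : Continuous fun t : ℝ => (s, t) := by fun_prop
  have := (continuous_scalarKernel hm hℓ).comp h
  exact this

theorem continuous_scalarKernel_left {m ℓ : ℝ} (hm : 0 < m) (hℓ : 0 < ℓ) (s : ℝ) :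
    Continuous fun t => scalarKernel m ℓ t s := by
  have h : Continuous fun t : ℝ => (t, s) := by fun_prop
  have := (continuous_scalarKernel hm hℓ).comp h
  exact this

theorem norm_scalarKernel_le {m ℓ : ℝ} (hm : 0 < m) (hℓ : 0 < ℓ) {c : ℝ} (hc0 : 0 ≤ c)
    (hc : c < Real.pi) : ∃ C : ℝ, 0 ≤ C ∧ ∀ s t : ℝ,
      ‖scalarKernel m ℓ s t‖ ≤ C * Real.exp (-(c * |s - t|)) / (1 + |s| + |t|) := by
  obtain ⟨E, hE0, hE⟩ := exists_one_add_pow_mul_exp_le 4 hc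
  obtain ⟨D, hD⟩ : ∃ D, D = ‖digammaSum 0‖ + 544 := ⟨_, rfl⟩
  have hD0 : 0 ≤ D := by rw [hD]; positivity
  obtain ⟨C, hC⟩ : ∃ C, C = 4 * (|logConst m ℓ| / 2 + D / 4) * E + 272 * E := ⟨_, rfl⟩
  refine ⟨C, by rw [hC]; positivity, fun s => ?_⟩
  have hne : ∀ t ∈ ({s}ᶜ : Set ℝ), ‖scalarKernel m ℓ s t‖
      ≤ C * Real.exp (-(c * |s - t|)) / (1 + |s| + |t|) := by
    intro t ht
    have hst : s ≠ t := fun h => ht h.symm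
    rw [le_div_iff₀ (by positivity)]
    calc _ ≤ _ := mul_le_mul_of_nonneg_right (norm_scalarKernel_le_of_ne hm hℓ hst) (by positivity)
      _ = _ := add_mul _ _ _
      _ ≤ _ := add_le_add (originTerm_le (by positivity) hc0 hD hE0 hE s t)
        (diagonalTerm_le hE hst)
      _ = _ := by rw [hC, add_mul]
  -- The bound extends to the diagonal by continuity.
  have hcont := continuous_scalarKernel_right hm hℓ s
  have hclosed : IsClosed {t : ℝ | ‖scalarKernel m ℓ s t‖
      ≤ C * Real.exp (-(c * |s - t|)) / (1 + |s| + |t|)} := by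
    refine isClosed_le hcont.norm (Continuous.div (by fun_prop) (by fun_prop) fun t => ?_)
    positivity
  intro t
  have h1 := hclosed.closure_subset_iff.2 hne
  rw [(dense_compl_singleton s).closure_eq] at h1
  exact h1 (mem_univ t)

/-! ### The diagonal -/

/-- L'Hôpital's rule at a common zero, for complex-valued functions of a real variable. -/
theorem tendsto_div_of_hasDerivAt {f g : ℝ → ℂ} {f' g' : ℂ} {x : ℝ} (hf : HasDerivAt f f' x)
    (hg : HasDerivAt g g' x) (hf0 : f x = 0) (hg0 : g x = 0) (hg' : g' ≠ 0) :
    Tendsto (fun y => f y / g y) (𝓝[≠] x) (𝓝 (f' / g')) := by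
  refine ((hasDerivAt_iff_tendsto_slope.1 hf).div (hasDerivAt_iff_tendsto_slope.1 hg) hg').congr' ?_
  filter_upwards [self_mem_nhdsWithin] with y hy
  have h1 : (((y - x)⁻¹ : ℝ) : ℂ) ≠ 0 := ofReal_ne_zero.2 (inv_ne_zero (sub_ne_zero.2 hy))
  rw [Pi.div_apply, slope_def_module, slope_def_module, hf0, hg0, sub_zero, sub_zero, real_smul,
    real_smul, mul_div_mul_left _ _ h1]

theorem hasDerivAt_digamma {z : ℂ} (hz : 0 < z.re) :
    HasDerivAt digamma (deriv digamma z) z := by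
  have hU : IsOpen {z : ℂ | 0 < z.re} := isOpen_lt continuous_const continuous_re
  have hG : DifferentiableOn ℂ Gamma {z : ℂ | 0 < z.re} := fun w hw =>
    (differentiableAt_Gamma w fun m h => by
      have h1 := congrArg Complex.re h
      simp only [neg_re, natCast_re] at h1
      have h2 : (0 : ℝ) ≤ m := Nat.cast_nonneg m
      have : 0 < w.re := hw
      linarith).differentiableWithinAt
  have hz' : {z : ℂ | 0 < z.re} ∈ 𝓝 z := hU.mem_nhds hz
  exact ((hG.deriv hU).differentiableAt hz' |>.div (hG.differentiableAt hz')
    (Gamma_ne_zero_of_re_pos hz)).hasDerivAt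

theorem hasDerivAt_digammaSum (s : ℝ) :
    HasDerivAt digammaSum
      (I * (deriv digamma (1 / 2 + I * s) - deriv digamma (1 / 2 - I * s))) s := by
  have h1 : HasDerivAt (fun s : ℝ => (1 / 2 + I * s : ℂ)) I s := by
    simpa using (((hasDerivAt_id s).ofReal_comp).const_mul I).const_add (1 / 2 : ℂ)
  have h2 : HasDerivAt (fun s : ℝ => (1 / 2 - I * s : ℂ)) (-I) s := by
    simpa using (((hasDerivAt_id s).ofReal_comp).const_mul I).const_sub (1 / 2 : ℂ)
  have h3 := (HasDerivAt.comp s (h₂ := digamma) (hasDerivAt_digamma (by simp)) h1).add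
    (HasDerivAt.comp s (h₂ := digamma) (hasDerivAt_digamma (by simp)) h2)
  refine h3.congr_deriv ?_
  ring

/-- The limit of the explicit form along the diagonal, legitimate because `K` is continuous. -/
theorem scalarKernel_self {m ℓ : ℝ} (hm : 0 < m) (hℓ : 0 < ℓ) (s : ℝ) :
    scalarKernel m ℓ s s = I / (4 * (Real.cosh (Real.pi * s) : ℂ) ^ 2)
          * (digammaSum s + 2 * (logConst m ℓ : ℂ))
        - 1 / (4 * (Real.pi : ℂ)) * (Real.tanh (Real.pi * s) : ℂ)
          * (deriv digamma (1 / 2 - I * (s : ℂ)) - deriv digamma (1 / 2 + I * (s : ℂ))) := by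
  have hpi : (Real.pi : ℂ) ≠ 0 := ofReal_ne_zero.2 Real.pi_ne_zero
  have hs : (Real.cosh (Real.pi * s) : ℂ) ≠ 0 := ofReal_ne_zero.2 (Real.cosh_pos _).ne'
  have hcont := continuous_scalarKernel_left hm hℓ s
  have hlim := (hcont.tendsto s).mono_left (nhdsWithin_le_nhds (s := {s}ᶜ))
  have hT : HasDerivAt (fun t : ℝ => (Real.tanh (Real.pi * t) : ℂ))
      (Real.pi / (Real.cosh (Real.pi * s) : ℂ) ^ 2) s := by
    have h := ((hasDerivAt_tanh (Real.pi * s)).comp s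
      ((hasDerivAt_id s).const_mul Real.pi)).ofReal_comp
    refine h.congr_deriv ?_
    push_cast
    ring
  have hnum := (hT.mul_const (digammaSum s)).fun_sub
    ((hasDerivAt_digammaSum s).const_mul (Real.tanh (Real.pi * s) : ℂ))
  have hden : HasDerivAt (fun t : ℝ => (Real.sinh (Real.pi * (t - s)) : ℂ)) Real.pi s := by
    have h := ((((hasDerivAt_id s).sub_const s).const_mul Real.pi).sinh).ofReal_comp
    refine h.congr_deriv ?_
    simp
  have hq := tendsto_div_of_hasDerivAt hnum hden (sub_self _) (by simp) hpi
  have hfirst : Tendsto (fun t : ℝ => I * (logConst m ℓ : ℂ)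
      / (2 * (Real.cosh (Real.pi * t) : ℂ) * (Real.cosh (Real.pi * s) : ℂ))) (𝓝[≠] s)
      (𝓝 (I * (logConst m ℓ : ℂ)
        / (2 * (Real.cosh (Real.pi * s) : ℂ) * (Real.cosh (Real.pi * s) : ℂ)))) := by
    have h : Continuous fun t : ℝ => I * (logConst m ℓ : ℂ)
        / (2 * (Real.cosh (Real.pi * t) : ℂ) * (Real.cosh (Real.pi * s) : ℂ)) :=
      Continuous.div (by fun_prop) (by fun_prop) fun t => mul_ne_zero (mul_ne_zero two_ne_zero
        (ofReal_ne_zero.2 (Real.cosh_pos _).ne')) hs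
    exact (h.tendsto s).mono_left nhdsWithin_le_nhds
  -- Off the diagonal `K` is the sum of a continuous term and `i / 4` times a quotient of functions
  -- that vanish at `t = s`.
  have hlim' := hfirst.add (hq.const_mul (I / 4))
  have heq := tendsto_nhds_unique (hlim.congr' ?_) hlim'
  · rw [heq]
    generalize deriv digamma (1 / 2 + I * s) = A
    generalize deriv digamma (1 / 2 - I * s) = B
    field_simp
    linear_combination (-2 * (Real.cosh (Real.pi * s) : ℂ) ^ 2 * (Real.tanh (Real.pi * s) : ℂ)
      * (A - B)) * I_sq
  · filter_upwards [self_mem_nhdsWithin] with t ht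
    have hr : (Real.sinh (Real.pi * (t - s)) : ℂ) ≠ 0 := ofReal_ne_zero.2
      (Real.sinh_ne_zero.2 (mul_ne_zero Real.pi_ne_zero (sub_ne_zero.2 ht)))
    rw [scalarKernel_of_ne hm hℓ ht]
    field_simp
    ring

/-! ### Symmetries, Schwartz property and matrix elements -/

theorem scalarKernel_symm {m ℓ : ℝ} (hm : 0 < m) (hℓ : 0 < ℓ) (s t : ℝ) :
    scalarKernel m ℓ s t = scalarKernel m ℓ t s := by
  rcases eq_or_ne s t with rfl | hst
  · rfl
  · rw [scalarKernel_of_ne hm hℓ hst, scalarKernel_of_ne hm hℓ hst.symm, ← neg_sub s t, mul_neg,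
      Real.sinh_neg]
    push_cast
    ring

theorem scalarKernel_neg_neg {m ℓ : ℝ} (hm : 0 < m) (hℓ : 0 < ℓ) (s t : ℝ) :
    scalarKernel m ℓ s t = scalarKernel m ℓ (-s) (-t) := by
  rcases eq_or_ne s t with rfl | hst
  · rw [scalarKernel_self hm hℓ, scalarKernel_self hm hℓ, digammaSum_neg, mul_neg, Real.cosh_neg,
      Real.tanh_neg, ofReal_neg, ofReal_neg, mul_neg I, sub_neg_eq_add, ← sub_eq_add_neg]
    ring
  · rw [scalarKernel_of_ne hm hℓ hst, scalarKernel_of_ne hm hℓ (neg_injective.ne hst),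
      digammaSum_neg, digammaSum_neg, ← neg_sub' s t, mul_neg, mul_neg, mul_neg, Real.sinh_neg,
      Real.cosh_neg, Real.cosh_neg, Real.tanh_neg, Real.tanh_neg]
    push_cast
    ring

theorem exists_schwartzMap_scalarKernel {m ℓ : ℝ} (hm : 0 < m) (hℓ : 0 < ℓ) (t : ℝ) :
    ∃ f : SchwartzMap ℝ ℂ, ∀ s : ℝ, f s = scalarKernel m ℓ s t := by
  obtain ⟨C, hC0, hC⟩ := norm_scalarKernel_le hm hℓ zero_le_one
    (by linarith [Real.pi_gt_three] : (1 : ℝ) < Real.pi)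
  have h : ContDiff ℝ (⊤ : ℕ∞) fun s : ℝ => (s, t) := contDiff_id.prodMk contDiff_const
  have hsmooth := (contDiff_scalarKernel hm hℓ).comp h
  refine exists_schwartzMap (f := fun s => scalarKernel m ℓ s t) (C := C * Real.exp |t|) hsmooth
    (norm_iteratedFDeriv_scalarKernel_le hm hℓ t) fun s => (hC s t).trans ?_
  have h1 : |s| ≤ |s - t| + |t| := by
    have := abs_add_le (s - t) t
    rwa [sub_add_cancel] at this
  refine (div_le_self (by positivity) (by linarith [abs_nonneg s, abs_nonneg t])).trans ?_
  rw [mul_assoc, ← Real.exp_add]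
  gcongr
  linarith

/-- Only the summand with spinor indices `a = k`, `b = l` survives, and there the perturbation
kernel is a multiple of `ε` times the logarithm. -/
theorem matrixIntegrand_eq (m ℓ : ℝ) (k l a b : Fin 2) (s t : ℝ) :
    matrixIntegrand m ℓ k l a b s t = fun p => (if a = k ∧ b = l then
      -((m : ℂ) / (2 * Real.pi * I)) * epsilon k l else 0) * scalarIntegrand m ℓ s t p := by
  funext p
  unfold matrixIntegrand scalarIntegrand eigenvector
  by_cases ha : a = k
  · by_cases hb : b = l
    · subst ha hb
      fin_cases a <;> fin_cases b <;> simp [perturbationKernel, epsilon] <;> ring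
    · simp [hb]
  · simp [ha]

theorem integrableOn_matrixIntegrand {m ℓ : ℝ} (hm : 0 < m) (hℓ : 0 < ℓ) (k l a b : Fin 2)
    (s t : ℝ) : IntegrableOn (matrixIntegrand m ℓ k l a b s t) (square ℓ) := by
  rw [matrixIntegrand_eq]
  exact (integrableOn_scalarIntegrand hm hℓ s t).const_mul _

theorem matrixElement_eq {m ℓ : ℝ} (hℓ : ℓ ≠ 0) (k l : Fin 2) (s t : ℝ) :
    matrixElement m ℓ k l s t = m * ℓ * epsilon k l * scalarKernel m ℓ s t := by
  have h : ∀ a b, ∫ p in square ℓ, matrixIntegrand m ℓ k l a b s t p = (if a = k ∧ b = l then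
      -((m : ℂ) / (2 * Real.pi * I)) * epsilon k l else 0)
        * ∫ p in square ℓ, scalarIntegrand m ℓ s t p := fun a b => by
    rw [matrixIntegrand_eq, integral_const_mul]
  unfold matrixElement
  simp only [h, ← Finset.sum_mul]
  rw [Finset.sum_eq_single_of_mem k (Finset.mem_univ k) fun a _ ha => by simp [ha],
    Finset.sum_eq_single_of_mem l (Finset.mem_univ l) fun b _ hb => by simp [hb],
    if_pos ⟨rfl, rfl⟩, scalarKernel]
  have h1 : (ℓ : ℂ) ≠ 0 := ofReal_ne_zero.2 hℓ
  have h2 : (Real.pi : ℂ) ≠ 0 := ofReal_ne_zero.2 Real.pi_ne_zero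
  rw [div_mul_eq_div_div, div_I]
  field_simp

theorem exists_norm_scalarKernel_le {m ℓ : ℝ} (hm : 0 < m) (hℓ : 0 < ℓ) {c : ℝ}
    (hc : c < Real.pi) : ∃ C : ℝ, ∀ s t : ℝ,
      ‖scalarKernel m ℓ s t‖ ≤ C * Real.exp (-c * |s - t|) / (1 + |s| + |t|) := by
  -- For negative `c` the bound is weaker than the one for `0`.
  obtain ⟨C, hC0, hC⟩ := norm_scalarKernel_le hm hℓ (le_max_right c 0) (max_lt hc Real.pi_pos)
  refine ⟨C, fun s t => (hC s t).trans ?_⟩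
  gcongr
  rw [neg_mul]
  exact neg_le_neg (mul_le_mul_of_nonneg_right (le_max_left c 0) (abs_nonneg _))

end MassPerturbation

theorem mainTheorem3 (m ℓ : ℝ) (hm : 0 < m) (hℓ : 0 < ℓ) :
    -- all double integrals converge absolutely
    (∀ (k l a b : Fin 2) (s t : ℝ), MeasureTheory.IntegrableOn
      (MassPerturbation.matrixIntegrand m ℓ k l a b s t) (MassPerturbation.square ℓ)) ∧
    (∀ s t : ℝ, MeasureTheory.IntegrableOn
      (MassPerturbation.scalarIntegrand m ℓ s t) (MassPerturbation.square ℓ)) ∧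
    -- the matrix elements
    (∀ (k l : Fin 2) (s t : ℝ), MassPerturbation.matrixElement m ℓ k l s t =
      (m : ℂ) * (ℓ : ℂ) * MassPerturbation.epsilon k l * MassPerturbation.scalarKernel m ℓ s t) ∧
    -- the explicit form off the diagonal
    (∀ s t : ℝ, s ≠ t → MassPerturbation.scalarKernel m ℓ s t =
      Complex.I * (MassPerturbation.logConst m ℓ : ℂ)
          / (2 * (Real.cosh (Real.pi * s) : ℂ) * (Real.cosh (Real.pi * t) : ℂ))
        - Complex.I * (Real.tanh (Real.pi * t) : ℂ)
          / (4 * (Real.sinh (Real.pi * (s - t)) : ℂ)) * MassPerturbation.digammaSum s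
        + Complex.I * (Real.tanh (Real.pi * s) : ℂ)
          / (4 * (Real.sinh (Real.pi * (s - t)) : ℂ)) * MassPerturbation.digammaSum t) ∧
    -- the coincidence case
    (∀ s : ℝ, MassPerturbation.scalarKernel m ℓ s s =
      Complex.I / (4 * (Real.cosh (Real.pi * s) : ℂ) ^ 2)
          * (MassPerturbation.digammaSum s + 2 * (MassPerturbation.logConst m ℓ : ℂ))
        - 1 / (4 * (Real.pi : ℂ)) * (Real.tanh (Real.pi * s) : ℂ)
          * (deriv Complex.digamma (1 / 2 - Complex.I * (s : ℂ))
            - deriv Complex.digamma (1 / 2 + Complex.I * (s : ℂ)))) ∧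
    -- joint smoothness
    ContDiff ℝ (⊤ : ℕ∞) (fun p : ℝ × ℝ => MassPerturbation.scalarKernel m ℓ p.1 p.2) ∧
    -- rapid decay in each variable, with all derivatives
    (∀ t : ℝ, ∃ f : SchwartzMap ℝ ℂ, ∀ s : ℝ, f s = MassPerturbation.scalarKernel m ℓ s t) ∧
    (∀ s : ℝ, ∃ f : SchwartzMap ℝ ℂ, ∀ t : ℝ, f t = MassPerturbation.scalarKernel m ℓ s t) ∧
    -- joint decay, exponential away from the diagonal; boundedness is the case `c = 0`
    (∀ c : ℝ, c < Real.pi → ∃ C : ℝ, ∀ s t : ℝ, ‖MassPerturbation.scalarKernel m ℓ s t‖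
      ≤ C * Real.exp (-c * |s - t|) / (1 + |s| + |t|)) ∧
    -- symmetries
    (∀ s t : ℝ, MassPerturbation.scalarKernel m ℓ s t = MassPerturbation.scalarKernel m ℓ t s) ∧
    (∀ s t : ℝ, MassPerturbation.scalarKernel m ℓ s t
      = MassPerturbation.scalarKernel m ℓ (-s) (-t)) := by
  refine ⟨MassPerturbation.integrableOn_matrixIntegrand hm hℓ,
    MassPerturbation.integrableOn_scalarIntegrand hm hℓ,
    MassPerturbation.matrixElement_eq hℓ.ne',
    fun s t => MassPerturbation.scalarKernel_of_ne hm hℓ,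
    MassPerturbation.scalarKernel_self hm hℓ,
    MassPerturbation.contDiff_scalarKernel hm hℓ,
    MassPerturbation.exists_schwartzMap_scalarKernel hm hℓ,
    fun s => ?_,
    fun c => MassPerturbation.exists_norm_scalarKernel_le hm hℓ,
    MassPerturbation.scalarKernel_symm hm hℓ,
    MassPerturbation.scalarKernel_neg_neg hm hℓ⟩
  obtain ⟨f, hf⟩ := MassPerturbation.exists_schwartzMap_scalarKernel hm hℓ s
  exact ⟨f, fun t => (hf t).trans (MassPerturbation.scalarKernel_symm hm hℓ t s)⟩
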